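/- Consider the metric allocation problem (MAP) on a finite metric space $(M,d)$ with $n$ points. An allocation is a point of the simplex $\Delta=\{x\in\mathbb{R}_{\ge 0}^M : \sum_{i\in M}x_i=1\}$. At each time step $t=1,2,\dots$ a convex non-increasing cost function $c_{t,i}\colon[0,1]\to\mathbb{R}_{\ge 0}$ is revealed for every $i\in M$. The algorithm, knowing only the cost functions revealed up to and including step $t$, moves from its allocation $x(t-1)\in\Delta$ to an allocation $x(t)\in\Delta$. It pays the service cost $\sum_{i\in M}c_{t,i}(x_i(t))$ and the movement cost $\min_f\sum_{i,j\in M}f(i,j)\,d(i,j)$, where the minimum is over all $f\colon M\times M\to\mathbb{R}_{\ge 0}$ with $x_i(t)-x_i(t-1)=\sum_{j\in M}(f(j,i)-f(i,j))$ for all $i\in M$. A deterministic online algorithm is $\rho$-competitive if there is a constant $B$, depending only on the metric space, such that for every initial allocation, every sequence of cost functions and every $T$, its total (service plus movement) cost over the first $T$ steps is at most $\rho$ times the total cost of any offline sequence of allocations with the same initial allocation, plus $B$. A metric space $M$ is a weighted star if there are weights $w_i>0$ $(i\in M)$ with $d(i,j)=w_i+w_j$ for all $i\ne j$. Theorem.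 There is an $O(\log n)$-competitive deterministic online algorithm for MAP on weighted star metrics. That is, there is an absolute constant $C>0$ such that for every $n\ge 2$ and every weighted star $M$ with $n$ points, there is a $C\log n$-competitive deterministic online algorithm for MAP on $M$. -/

import Mathlib

noncomputable section

namespace MetricAllocation

/-- A cost function for a single point: a convex, non-increasing function `[0,1] → ℝ₊`, describing
the cost of a task as a function of the amount of resource available. Only the values on `[0,1]`
are ever used. -/
structure CostFunction where
  toFun : ℝ → ℝ
  nonneg : ∀ s ∈ Set.Icc (0 : ℝ) 1, 0 ≤ toFun s
  antitone : AntitoneOn toFun (Set.Icc (0 : ℝ) 1)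
  convex : ConvexOn ℝ (Set.Icc (0 : ℝ) 1) toFun

/-- The tasks arriving in one time step: one cost function for every point of the space. -/
abbrev Request (M : Type*) := M → CostFunction

/-- Allocations of one unit of resource to the points of `M`: the simplex
`{x : M → ℝ | (∀ i, 0 ≤ x i) ∧ ∑ i, x i = 1}`. -/
abbrev Allocation (M : Type*) [Fintype M] := {x : M → ℝ // x ∈ stdSimplex ℝ M}

/-- `f` is a flow that transforms `x` into `y`: it sends the amount `f i j ≥ 0` from `i` to `j`. -/
def IsFlow {M : Type*} [Fintype M] (x y : M → ℝ) (f : M → M → ℝ) : Prop :=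
  (∀ i j, 0 ≤ f i j) ∧ ∀ i, y i - x i = ∑ j, (f j i - f i j)

/-- The movement cost from `x` to `y`: the least cost of a flow from `x` to `y`, where sending an
amount `ε` from `i` to `j` costs `ε * dist i j`. -/
def movementCost {M : Type*} [Fintype M] [MetricSpace M] (x y : Allocation M) : ℝ :=
  sInf {κ : ℝ | ∃ f : M → M → ℝ, IsFlow x.1 y.1 f ∧ κ = ∑ i, ∑ j, f i j * dist i j}

/-- The service cost of the allocation `x` for the request `c`. -/
def serviceCost {M : Type*} [Fintype M] (c : Request M) (x : Allocation M) : ℝ :=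
  ∑ i, (c i).toFun (x.1 i)

/-- The total (movement plus service) cost over the first `T` time steps of the schedule
`z 0, z 1, z 2, …` on the request sequence `c`. Here `z 0` is the initial allocation, the request
of time step `t + 1` is `c t`, and it is served in the allocation `z (t + 1)`. -/
def totalCost {M : Type*} [Fintype M] [MetricSpace M] (c : ℕ → Request M)
    (z : ℕ → Allocation M) (T : ℕ) : ℝ :=
  ∑ t ∈ Finset.range T, (movementCost (z t) (z (t + 1)) + serviceCost (c t) (z (t + 1)))

/-- A deterministic online algorithm: it determines the current allocation from the list of the
requests revealed so far (including the current one). -/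
def OnlineAlgorithm (M : Type*) [Fintype M] := List (Request M) → Allocation M

/-- The schedule that an online algorithm produces on a request sequence. -/
def OnlineAlgorithm.schedule {M : Type*} [Fintype M] (A : OnlineAlgorithm M)
    (c : ℕ → Request M) (t : ℕ) : Allocation M :=
  A ((List.range t).map c)

/-- There is a `ρ`-competitive deterministic online algorithm for metric allocation on `M`: up to
an additive constant `B` that depends only on the space, from every initial allocation the cost
of the algorithm is at most `ρ` times the cost of any offline schedule for the same requests that
starts at the same allocation. -/
def HasCompetitiveAlgorithm (M : Type*) [Fintype M] [MetricSpace M] (ρ : ℝ) : Prop :=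
  ∃ B : ℝ, ∀ x₀ : Allocation M, ∃ A : OnlineAlgorithm M, A [] = x₀ ∧
    ∀ (c : ℕ → Request M) (T : ℕ) (y : ℕ → Allocation M), y 0 = x₀ →
      totalCost c (A.schedule c) T ≤ ρ * totalCost c y T + B

/-- `M` is a weighted star: there are weights `w i > 0` such that the distance between two distinct
points `i` and `j` is `w i + w j`. -/
def IsWeightedStar (M : Type*) [MetricSpace M] : Prop :=
  ∃ w : M → ℝ, (∀ i, 0 < w i) ∧ ∀ i j, i ≠ j → dist i j = w i + w j

end MetricAllocation

end

/-!
Split the resource interval `[0, 1]` of every point into `N` slots. A state of the algorithm records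
for every slot the fraction `z` of it that is empty; a request with convex non-increasing costs
becomes a linear cost `∑ g * z` on the slots, whose coefficients `g` decrease from the bottom slot to
the top one (`convexOn_le_sum_slots`, `sum_deficit_mul_le`). This makes entropic descent on `z` with
shift `δ = 1 / n` available, where `n` is the number of points: under a force `g` at a point of
weight `w`, the quantity `z + δ` shrinks by the factor `exp (-g / w)` (`exists_raise_slot`). The
excess mass created in this way then has to be removed (`exists_restore`).

Which slots give up mass is the decisive choice. The problem has no intrinsic scale: if the
nonempty slots have total length `1 + ε`, then the competition takes place on the scale `ε`, and the
shift `δ` must not act on more than length about `n * ε`. So only the highest nonempty slots of each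
point, of length `ε` per point, lose mass, at the rate `(z + δ) / w`. Let `a` be the empty fractions
of an offline allocation. The potential is the weighted sum of
`z / 2 - a * log ((z + δ) / (1 + δ))` over the slots. While mass is removed it changes at a rate of at
most `∑ (z + δ) / 2 - ∑ a`, summed over the active slots. There `∑ z ≤ ε`, as this is all the empty
space in nonempty slots; `∑ δ ≤ n * ε * δ ≤ ε`; and `∑ a ≥ ε`, because the offline allocation fills
slots from below and has only one unit to fill a length `1 + ε` (`le_sum_top_deficit`). Hence the
potential does not increase. While mass is added, the potential drops by half the upward movement up
to the offline cost `∑ g * a`, and that movement in turn dominates the online cost `∑ g * z`. An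
offline movement raises the potential by at most a factor `log ((1 + δ) / δ) = log (n + 1)` times its
cost (`potential_le_add`). This gives the ratio `O(log n)`.

The dynamics runs in many small substeps per request; the position actually taken is the best of
them (`exists_best_substep`), mixed with a little of the uniform allocation so that the costs become
Lipschitz. As the potential is linear in `a`, the slots can be refined at no cost between requests
(`potential_refineSlots`), which makes the discretization errors summable (`exists_step`). On a
weighted star the movement cost is a weighted `ℓ¹` distance (`movementCost_eq_weightedDist`).
-/

noncomputable section

namespace MetricAllocation

variable {M : Type*} [Fintype M]

/-! ### Movement on a weighted star -/

/-- The weighted `ℓ¹` distance `∑ i, w i * |x i - y i|`, which is the transport distance between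
allocations on the star with weights `w`. -/
def weightedDist (w : M → ℝ) (x y : M → ℝ) : ℝ := ∑ i, w i * |x i - y i|

theorem weightedDist_triangle {w : M → ℝ} (hw : ∀ i, 0 ≤ w i) (x y z : M → ℝ) :
    weightedDist w x z ≤ weightedDist w x y + weightedDist w y z := by
  unfold weightedDist
  rw [← Finset.sum_add_distrib]
  refine Finset.sum_le_sum fun i _ => ?_
  rw [← mul_add]
  exact mul_le_mul_of_nonneg_left (abs_sub_le _ _ _) (hw i)

theorem weightedDist_self (w x : M → ℝ) : weightedDist w x x = 0 := by
  simp [weightedDist]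

theorem weightedDist_comm (w x y : M → ℝ) : weightedDist w x y = weightedDist w y x := by
  simp [weightedDist, abs_sub_comm]

/-- Mass lost at `i` is sent to the points `j` in proportion to the mass gained there. -/
theorem exists_flow_le {w : M → ℝ} [MetricSpace M] (hw : ∀ i, 0 < w i)
    (hd : ∀ i j : M, i ≠ j → dist i j = w i + w j) (x y : Allocation M) :
    ∃ f : M → M → ℝ, IsFlow x.1 y.1 f ∧ ∑ i, ∑ j, f i j * dist i j ≤ weightedDist w x.1 y.1 := by
  set p : M → ℝ := fun i => max (y.1 i - x.1 i) 0 with hp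
  set q : M → ℝ := fun i => max (x.1 i - y.1 i) 0 with hq
  have hp0 : ∀ i, 0 ≤ p i := fun i => le_max_right _ _
  have hq0 : ∀ i, 0 ≤ q i := fun i => le_max_right _ _
  have hpq : ∀ i, p i - q i = y.1 i - x.1 i := by
    intro i
    simp only [hp, hq]
    rcases le_total (y.1 i) (x.1 i) with h | h
    · rw [max_eq_right (by linarith), max_eq_left (by linarith)]; ring
    · rw [max_eq_left (by linarith), max_eq_right (by linarith)]; ring
  have hpq' : ∀ i, p i + q i = |x.1 i - y.1 i| := by
    intro i
    simp only [hp, hq]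
    rcases le_total (y.1 i) (x.1 i) with h | h
    · rw [max_eq_right (by linarith), max_eq_left (by linarith), abs_of_nonneg (by linarith)]; ring
    · rw [max_eq_left (by linarith), max_eq_right (by linarith), abs_of_nonpos (by linarith)]; ring
  set s : ℝ := ∑ i, p i with hs
  have hsq : ∑ i, q i = s := by
    have h1 : ∑ i, (p i - q i) = 0 := by
      simp only [hpq, Finset.sum_sub_distrib, x.2.2, y.2.2, sub_self]
    rw [Finset.sum_sub_distrib] at h1
    linarith
  have hs0 : 0 ≤ s := Finset.sum_nonneg fun i _ => hp0 i
  -- The division below is harmless for `s = 0`: then `p` and `q` vanish.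
  have hps : ∀ i, p i * s / s = p i := by
    intro i
    rcases hs0.eq_or_lt with h | h
    · have := (Finset.sum_eq_zero_iff_of_nonneg (fun i _ => hp0 i)).1 h.symm i (Finset.mem_univ i)
      simp [this]
    · field_simp
  have hqs : ∀ i, q i * s / s = q i := by
    intro i
    rcases hs0.eq_or_lt with h | h
    · have := (Finset.sum_eq_zero_iff_of_nonneg (fun i _ => hq0 i)).1 (hsq.trans h.symm) i
        (Finset.mem_univ i)
      simp [this]
    · field_simp
  have row : ∀ i, ∑ j, q i * p j / s = q i := by
    intro i; rw [← Finset.sum_div, ← Finset.mul_sum, hqs]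
  have col : ∀ j, ∑ i, q i * p j / s = p j := by
    intro j; rw [← Finset.sum_div, ← Finset.sum_mul, hsq, mul_comm, hps]
  refine ⟨fun i j => q i * p j / s, ⟨fun i j => by have := hq0 i; have := hp0 j; positivity,
    fun i => ?_⟩, ?_⟩
  · rw [Finset.sum_sub_distrib, row, col, hpq]
  · have hle : ∀ i j : M, dist i j ≤ w i + w j := by
      intro i j
      by_cases h : i = j
      · subst h; rw [dist_self]; linarith [hw i]
      · exact (hd i j h).le
    calc ∑ i, ∑ j, q i * p j / s * dist i j
        ≤ ∑ i, ∑ j, (w i * (q i * p j / s) + w j * (q i * p j / s)) := by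
          refine Finset.sum_le_sum fun i _ => Finset.sum_le_sum fun j _ => ?_
          have h1 : 0 ≤ q i * p j / s := by have := hq0 i; have := hp0 j; positivity
          nlinarith [mul_le_mul_of_nonneg_left (hle i j) h1]
      _ = ∑ i, w i * q i + ∑ j, w j * p j := by
          simp only [Finset.sum_add_distrib]
          congr 1
          · simp only [← Finset.mul_sum, row]
          · rw [Finset.sum_comm]; simp only [← Finset.mul_sum, col]
      _ = weightedDist w x.1 y.1 := by
          unfold weightedDist
          rw [← Finset.sum_add_distrib]
          refine Finset.sum_congr rfl fun i _ => ?_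
          rw [← hpq']; ring

theorem weightedDist_le_of_isFlow {w : M → ℝ} [MetricSpace M] (hw : ∀ i, 0 < w i)
    (hd : ∀ i j : M, i ≠ j → dist i j = w i + w j) {x y : M → ℝ} {f : M → M → ℝ}
    (hf : IsFlow x y f) : weightedDist w x y ≤ ∑ i, ∑ j, f i j * dist i j := by
  classical
  -- The loops `f i i` cost nothing and move nothing.
  set h : M → M → ℝ := fun i j => if i = j then 0 else f i j with hh
  have hh0 : ∀ i j, 0 ≤ h i j := by
    intro i j; simp only [hh]; split_ifs; exacts [le_rfl, hf.1 i j]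
  have hnet : ∀ i j, f j i - f i j = h j i - h i j := by
    intro i j; simp only [hh]
    by_cases e : i = j
    · subst e; simp
    · rw [if_neg e, if_neg (Ne.symm e)]
  have hcost : ∀ i j, f i j * dist i j = w i * h i j + w j * h i j := by
    intro i j; simp only [hh]
    by_cases e : i = j
    · subst e; simp
    · rw [if_neg e, hd i j e]; ring
  calc weightedDist w x y ≤ ∑ i, w i * ∑ j, (h j i + h i j) := by
        refine Finset.sum_le_sum fun i _ => mul_le_mul_of_nonneg_left ?_ (hw i).le
        rw [abs_sub_comm, hf.2 i]
        refine (Finset.abs_sum_le_sum_abs _ _).trans (Finset.sum_le_sum fun j _ => ?_)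
        rw [hnet, abs_le]
        constructor <;> linarith [hh0 i j, hh0 j i]
    _ = ∑ i, ∑ j, f i j * dist i j := by
        simp only [hcost, Finset.sum_add_distrib, mul_add, Finset.mul_sum]
        rw [add_comm]
        congr 1
        exact Finset.sum_comm

/-- On a weighted star the transport distance is the weighted `ℓ¹` distance. -/
theorem movementCost_eq_weightedDist {w : M → ℝ} [MetricSpace M] (hw : ∀ i, 0 < w i)
    (hd : ∀ i j : M, i ≠ j → dist i j = w i + w j) (x y : Allocation M) :
    movementCost x y = weightedDist w x.1 y.1 := by
  obtain ⟨f, hf, hfle⟩ := exists_flow_le hw hd x y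
  have hlow : ∀ κ ∈ {κ : ℝ | ∃ f : M → M → ℝ, IsFlow x.1 y.1 f ∧
      κ = ∑ i, ∑ j, f i j * dist i j}, weightedDist w x.1 y.1 ≤ κ := by
    rintro κ ⟨f, hf, rfl⟩
    exact weightedDist_le_of_isFlow hw hd hf
  refine le_antisymm ((csInf_le ⟨_, hlow⟩ ⟨f, hf, rfl⟩).trans hfle) (le_csInf ⟨_, f, hf, rfl⟩ hlow)

/-! ### Slots and offline deficits -/

/-- Divide `[0, 1]` into `N` slots `[j / N, (j + 1) / N]`. If a point holds the amount `y`, filling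
its slots from below, then `deficit N y j` is the fraction of slot `j` that stays empty. -/
def deficit (N : ℕ) (y : ℝ) (j : ℕ) : ℝ := max ((j : ℝ) + 1 - N * y) 0 - max ((j : ℝ) - N * y) 0

theorem deficit_nonneg (N : ℕ) (y : ℝ) (j : ℕ) : 0 ≤ deficit N y j :=
  sub_nonneg.2 (max_le_max (by linarith) le_rfl)

theorem deficit_le_one (N : ℕ) (y : ℝ) (j : ℕ) : deficit N y j ≤ 1 := by
  unfold deficit
  rcases le_total ((j : ℝ) - N * y) 0 with h | h
  · rw [max_eq_right h]
    have : max ((j : ℝ) + 1 - N * y) 0 ≤ 1 := max_le (by linarith) zero_le_one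
    linarith
  · rw [max_eq_left h, max_eq_left (by linarith)]; linarith

theorem deficit_eq_zero {N : ℕ} {y : ℝ} {j : ℕ} (h : (j : ℝ) + 1 ≤ N * y) : deficit N y j = 0 := by
  unfold deficit
  rw [max_eq_right (by linarith), max_eq_right (by linarith), sub_self]

theorem deficit_eq_one {N : ℕ} {y : ℝ} {j : ℕ} (h : N * y ≤ j) : deficit N y j = 1 := by
  unfold deficit
  rw [max_eq_left (by linarith), max_eq_left (by linarith)]; ring

/-- Slots are filled from below: below a slot that is not empty all slots are full. -/
theorem deficit_eq_zero_of_lt {N : ℕ} {y : ℝ} {j k : ℕ} (hjk : j < k) (hk : deficit N y k < 1) :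
    deficit N y j = 0 := by
  apply deficit_eq_zero
  by_contra! h
  have : (j : ℝ) + 1 ≤ k := by exact_mod_cast hjk
  exact hk.ne (deficit_eq_one (by linarith))

theorem sum_deficit {N : ℕ} {y : ℝ} (h0 : 0 ≤ y) (h1 : y ≤ 1) :
    ∑ j ∈ Finset.range N, deficit N y j = N - N * y := by
  have := Finset.sum_range_sub (fun j : ℕ => max ((j : ℝ) - N * y) 0) N
  have hN : (0 : ℝ) ≤ N := Nat.cast_nonneg N
  simp only [Nat.cast_add, Nat.cast_one, Nat.cast_zero] at this
  unfold deficit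
  rw [this, max_eq_left (by nlinarith), max_eq_right (by nlinarith)]; ring

theorem deficit_antitone (N : ℕ) (j : ℕ) : Antitone fun y => deficit N y j := by
  intro y y' h
  have hN : (N : ℝ) * y ≤ N * y' := mul_le_mul_of_nonneg_left h (Nat.cast_nonneg N)
  simp only [deficit]
  rcases le_total ((j : ℝ) - N * y') 0 with h1 | h1
  · rw [max_eq_right h1]
    rcases le_total ((j : ℝ) - N * y) 0 with h2 | h2
    · rw [max_eq_right h2]
      have := max_le_max (show (j : ℝ) + 1 - N * y' ≤ j + 1 - N * y by linarith) (le_refl (0 : ℝ))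
      linarith
    · rw [max_eq_left h2, max_eq_left (show (0 : ℝ) ≤ j + 1 - N * y by linarith)]
      have := max_le (show (j : ℝ) + 1 - N * y' ≤ 1 by linarith) zero_le_one
      linarith
  · rw [max_eq_left h1, max_eq_left (by linarith), max_eq_left (by linarith),
      max_eq_left (by linarith)]
    linarith

theorem sum_deficit_refine {R : ℕ} (hR : 0 < R) (N : ℕ) (y : ℝ) (j : ℕ) :
    ∑ k ∈ Finset.range R, deficit (N * R) y (j * R + k) = R * deficit N y j := by
  have hR' : (0 : ℝ) < R := by exact_mod_cast hR
  have := Finset.sum_range_sub (fun k : ℕ => max ((j : ℝ) * R + k - N * R * y) 0) R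
  unfold deficit
  push_cast at this ⊢
  simp only [← add_assoc] at this
  rw [this, mul_sub, mul_max_of_nonneg _ _ hR'.le, mul_max_of_nonneg _ _ hR'.le]
  congr 2 <;> ring

/-! ### The slot potential -/

/-- The contribution of one slot to the potential: `z` and `a` are the empty fractions of the slot
in the online and in the offline allocation. -/
def slotPotential (δ z a : ℝ) : ℝ := z / 2 - a * Real.log ((z + δ) / (1 + δ))

theorem slotPotential_nonneg {δ z a : ℝ} (hδ : 0 < δ) (hz : z ∈ Set.Icc (0 : ℝ) 1) (ha : 0 ≤ a) :
    0 ≤ slotPotential δ z a := by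
  have h1 : Real.log ((z + δ) / (1 + δ)) ≤ 0 := by
    apply Real.log_nonpos
    · have := hz.1; positivity
    · rw [div_le_one (by linarith)]; linarith [hz.2]
  unfold slotPotential
  nlinarith [hz.1, mul_nonneg ha (neg_nonneg.2 h1)]

theorem neg_log_le {δ z : ℝ} (hδ : 0 < δ) (hz : z ∈ Set.Icc (0 : ℝ) 1) :
    -Real.log ((z + δ) / (1 + δ)) ≤ Real.log ((1 + δ) / δ) := by
  rw [← Real.log_inv, inv_div]
  apply Real.log_le_log
  · have := hz.1; positivity
  · exact div_le_div_of_nonneg_left (by linarith) hδ (by linarith [hz.1])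

theorem slotPotential_sub {δ z z' a : ℝ} (hδ : 0 < δ) (hz : 0 ≤ z) (hz' : 0 ≤ z') :
    slotPotential δ z' a - slotPotential δ z a
      = (z' - z) / 2 - a * (Real.log (z' + δ) - Real.log (z + δ)) := by
  unfold slotPotential
  rw [Real.log_div (by positivity) (by positivity), Real.log_div (by positivity) (by positivity)]
  ring

/-! ### The highest nonempty slots -/

/-- The `m` greatest elements of `S`, or all of `S` if it has fewer. -/
theorem exists_top (S : Finset ℕ) (m : ℕ) : ∃ A ⊆ S, A.card ≤ m ∧ (A.card = m ∨ A = S) ∧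
    ∀ j ∈ S, j ∉ A → ∀ k ∈ A, j < k := by
  induction m with
  | zero => exact ⟨∅, by simp, by simp, by simp, by simp⟩
  | succ m ih =>
    obtain ⟨A, hAS, hle, hcard, htop⟩ := ih
    by_cases hA : A = S
    · exact ⟨A, hAS, by omega, Or.inr hA, htop⟩
    · have hcm : A.card = m := hcard.resolve_right hA
      have hne : (S \ A).Nonempty := by
        rw [Finset.sdiff_nonempty]
        exact fun h => hA (Finset.Subset.antisymm hAS h)
      have hmem := Finset.max'_mem _ hne
      have hmax := Finset.le_max' (S \ A)
      set b := (S \ A).max' hne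
      rw [Finset.mem_sdiff] at hmem
      refine ⟨insert b A, Finset.insert_subset hmem.1 hAS, ?_, Or.inl ?_, ?_⟩
      · rw [Finset.card_insert_of_notMem hmem.2]; omega
      · rw [Finset.card_insert_of_notMem hmem.2]; omega
      · intro j hj hjA k hk
        rw [Finset.mem_insert, not_or] at hjA
        rcases Finset.mem_insert.1 hk with rfl | hk
        · exact lt_of_le_of_ne (hmax j (Finset.mem_sdiff.2 ⟨hj, hjA.2⟩)) hjA.1
        · exact htop j hj hjA.2 k hk

/-- Empty space sits at the top: the `m` highest slots of `S` either are all empty or contain all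
the empty space of `S`. -/
theorem sum_top_deficit {S A : Finset ℕ} {m : ℕ} (hcard : A.card = m ∨ A = S) (hAS : A ⊆ S)
    (htop : ∀ j ∈ S, j ∉ A → ∀ k ∈ A, j < k) (N : ℕ) (y : ℝ) :
    ∑ j ∈ A, deficit N y j = m ∨ ∑ j ∈ A, deficit N y j = ∑ j ∈ S, deficit N y j := by
  rcases hcard with hcard | rfl
  · by_cases h : ∃ k ∈ A, deficit N y k < 1
    · obtain ⟨k, hk, hk1⟩ := h
      right
      exact Finset.sum_subset hAS fun j hj hjA =>
        deficit_eq_zero_of_lt (htop j hj hjA k hk) hk1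
    · push Not at h
      left
      rw [Finset.sum_congr rfl fun j hj => (deficit_le_one N y j).antisymm (h j hj)]
      simp [hcard]
  · exact Or.inr rfl

/-- If `S i` is a set of slots at every point, `N + m` slots in all, then any allocation of one unit
leaves at least `m` slots' worth of empty space among the `m` highest slots of each `S i`. -/
theorem le_sum_top_deficit {N m : ℕ} {S A : M → Finset ℕ} (hS : ∀ i, S i ⊆ Finset.range N)
    (hm : ∑ i, (S i).card = N + m) (hcard : ∀ i, (A i).card = m ∨ A i = S i)
    (hAS : ∀ i, A i ⊆ S i) (htop : ∀ i, ∀ j ∈ S i, j ∉ A i → ∀ k ∈ A i, j < k)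
    {y : M → ℝ} (hy : y ∈ stdSimplex ℝ M) :
    (m : ℝ) ≤ ∑ i, ∑ j ∈ A i, deficit N (y i) j := by
  have hnn : ∀ i, 0 ≤ ∑ j ∈ A i, deficit N (y i) j :=
    fun i => Finset.sum_nonneg fun j _ => deficit_nonneg _ _ _
  by_cases h : ∃ i, ∑ j ∈ A i, deficit N (y i) j = m
  · obtain ⟨i, hi⟩ := h
    rw [← hi]
    exact Finset.single_le_sum (f := fun i => ∑ j ∈ A i, deficit N (y i) j)
      (fun i _ => hnn i) (Finset.mem_univ i)
  · push Not at h
    have hi : ∀ i, ((S i).card : ℝ) - N * y i ≤ ∑ j ∈ A i, deficit N (y i) j := by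
      intro i
      rw [(sum_top_deficit (hcard i) (hAS i) (htop i) N (y i)).resolve_left (h i)]
      have hyi : y i ≤ 1 := by
        rw [← hy.2]
        exact Finset.single_le_sum (fun i _ => hy.1 i) (Finset.mem_univ i)
      have h1 : ∑ j ∈ S i, (1 - deficit N (y i) j)
          ≤ ∑ j ∈ Finset.range N, (1 - deficit N (y i) j) :=
        Finset.sum_le_sum_of_subset_of_nonneg (hS i)
          fun j _ _ => sub_nonneg.2 (deficit_le_one _ _ _)
      simp only [Finset.sum_sub_distrib, Finset.sum_const, Finset.card_range, nsmul_eq_mul,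
        mul_one, sum_deficit (hy.1 i) hyi] at h1
      linarith
    have h2 := Finset.sum_le_sum fun i (_ : i ∈ Finset.univ) => hi i
    rw [Finset.sum_sub_distrib, ← Finset.mul_sum, hy.2, ← Nat.cast_sum, hm] at h2
    push_cast at h2
    linarith

/-! ### Removal of excess mass -/

/-- The amount of resource in the slots, in units of one slot, if `z i j` is the empty fraction of
slot `j` of point `i`. -/
def slotMass (N : ℕ) (z : M → ℕ → ℝ) : ℝ := ∑ i, ∑ j ∈ Finset.range N, (1 - z i j)

/-- The sum of the slot potentials against the offline allocation `y`, with weights `w`. -/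
def slotPotentialSum (w : M → ℝ) (δ : ℝ) (N : ℕ) (z : M → ℕ → ℝ) (y : M → ℝ) : ℝ :=
  ∑ i, w i * ∑ j ∈ Finset.range N, slotPotential δ (z i j) (deficit N (y i) j)

/-- The slots of the point `i` that are not empty. -/
def occupied (N : ℕ) (z : M → ℕ → ℝ) (i : M) : Finset ℕ := (Finset.range N).filter fun j => z i j < 1

/-- With `m` the number of nonempty slots in excess of `N`, let the `m` highest nonempty slots of every
point lose mass at the rate `(z + δ) / w`, until one unit of mass is left or one more slot is empty.
Counting nonempty slots makes `m` exactly the empty space that these slots hold once one unit is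
left. -/
theorem exists_partial_restore [Nonempty M] {w : M → ℝ} (hw : ∀ i, 0 < w i) {δ : ℝ} (hδ : 0 < δ)
    (hδn : Fintype.card M * δ ≤ 1) {N : ℕ} {z : M → ℕ → ℝ}
    (hz : ∀ i j, z i j ∈ Set.Icc (0 : ℝ) 1) (hN : (N : ℝ) < slotMass N z) :
    ∃ z' : M → ℕ → ℝ, (∀ i j, z' i j ∈ Set.Icc (0 : ℝ) 1) ∧ (∀ i j, z i j ≤ z' i j) ∧
      (N : ℝ) ≤ slotMass N z' ∧
      (slotMass N z' = N ∨ ∑ i, (occupied N z' i).card < ∑ i, (occupied N z i).card) ∧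
      ∀ y ∈ stdSimplex ℝ M, slotPotentialSum w δ N z' y ≤ slotPotentialSum w δ N z y := by
  classical
  have hmass : ∀ v : M → ℕ → ℝ, (∀ i, ∀ j ∈ Finset.range N, j ∉ occupied N z i → v i j = 1) →
      slotMass N v = ∑ i, ((occupied N z i).card : ℝ) - ∑ i, ∑ j ∈ occupied N z i, v i j := by
    intro v hv
    unfold slotMass
    rw [← Finset.sum_sub_distrib]
    refine Finset.sum_congr rfl fun i _ => ?_
    rw [← Finset.sum_subset (Finset.filter_subset (fun j => z i j < 1) (Finset.range N))]
    · simp [Finset.sum_sub_distrib, occupied]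
    · intro j hj hj'; rw [hv i j hj hj', sub_self]
  have hz1 : ∀ i, ∀ j ∈ Finset.range N, j ∉ occupied N z i → z i j = 1 := by
    intro i j hj hj'
    simp only [occupied, Finset.mem_filter, not_and, not_lt] at hj'
    exact (hz i j).2.antisymm (hj' hj)
  have hlt : N < ∑ i, (occupied N z i).card := by
    have h1 := hmass z hz1
    have h2 : 0 ≤ ∑ i, ∑ j ∈ occupied N z i, z i j :=
      Finset.sum_nonneg fun i _ => Finset.sum_nonneg fun j _ => (hz i j).1
    have : (N : ℝ) < ((∑ i, (occupied N z i).card : ℕ) : ℝ) := by push_cast; linarith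
    exact_mod_cast this
  obtain ⟨m, hm⟩ : ∃ m, ∑ i, (occupied N z i).card = N + m := ⟨_, (Nat.add_sub_of_le hlt.le).symm⟩
  have hm0 : 0 < m := by omega
  choose A hAS hAle hAcard hAtop using fun i => exists_top (occupied N z i) m
  have hAz : ∀ i, ∀ j ∈ A i, z i j < 1 := fun i j hj => (Finset.mem_filter.1 (hAS i hj)).2
  have hAr : ∀ i, A i ⊆ Finset.range N := fun i => (hAS i).trans (Finset.filter_subset _ _)
  set u : ℝ → M → ℕ → ℝ := fun τ i j =>
    if j ∈ A i then (z i j + δ) * Real.exp (τ / w i) - δ else z i j with hu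
  have hu_le : ∀ τ, 0 ≤ τ → ∀ i j, z i j ≤ u τ i j := by
    intro τ hτ i j
    simp only [hu]
    split_ifs
    · have h1 : 1 ≤ Real.exp (τ / w i) := Real.one_le_exp (div_nonneg hτ (hw i).le)
      have h2 : 0 < z i j + δ := by linarith [(hz i j).1]
      nlinarith
    · exact le_rfl
  have hu_out : ∀ τ i, ∀ j ∈ Finset.range N, j ∉ occupied N z i → u τ i j = 1 := by
    intro τ i j hj hj'
    simp only [hu]
    rw [if_neg fun h => hj' (hAS i h)]
    exact hz1 i j hj hj'
  -- As long as the total mass is at least one unit, the potential does not increase.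
  have hpot : ∀ τ, 0 ≤ τ → (N : ℝ) ≤ slotMass N (u τ) → ∀ y ∈ stdSimplex ℝ M,
      slotPotentialSum w δ N (u τ) y ≤ slotPotentialSum w δ N z y := by
    intro τ hτ hNτ y hy
    have hterm : ∀ i, w i * ∑ j ∈ Finset.range N, slotPotential δ (u τ i j) (deficit N (y i) j)
        - w i * ∑ j ∈ Finset.range N, slotPotential δ (z i j) (deficit N (y i) j)
        ≤ τ * ∑ j ∈ A i, ((u τ i j + δ) / 2 - deficit N (y i) j) := by
      intro i
      rw [← mul_sub, ← Finset.sum_sub_distrib, ← Finset.sum_subset (hAr i), Finset.mul_sum,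
        Finset.mul_sum]
      · refine Finset.sum_le_sum fun j hj => ?_
        have h2 : 0 < z i j + δ := by linarith [(hz i j).1]
        rw [slotPotential_sub hδ (hz i j).1 ((hz i j).1.trans (hu_le τ hτ i j))]
        have huj : u τ i j = (z i j + δ) * Real.exp (τ / w i) - δ := if_pos hj
        have hlog : Real.log (u τ i j + δ) = Real.log (z i j + δ) + τ / w i := by
          rw [huj, sub_add_cancel, Real.log_mul h2.ne' (Real.exp_pos _).ne', Real.log_exp]
        have hexp : Real.exp (τ / w i) - 1 ≤ τ / w i * Real.exp (τ / w i) := by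
          have := Real.add_one_le_exp (-(τ / w i))
          rw [Real.exp_neg] at this
          have hpos := Real.exp_pos (τ / w i)
          have h3 := mul_le_mul_of_nonneg_right this hpos.le
          rw [inv_mul_cancel₀ hpos.ne'] at h3
          linarith
        have hinc : w i * (u τ i j - z i j) ≤ τ * (u τ i j + δ) := by
          have e1 : w i * (u τ i j - z i j)
              = w i * ((z i j + δ) * (Real.exp (τ / w i) - 1)) := by rw [huj]; ring
          have e2 : τ * (u τ i j + δ)
              = w i * ((z i j + δ) * (τ / w i * Real.exp (τ / w i))) := by
            rw [huj]; have := (hw i).ne'; field_simp; ring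
          rw [e1, e2]
          exact mul_le_mul_of_nonneg_left (mul_le_mul_of_nonneg_left hexp h2.le) (hw i).le
        rw [hlog]
        have e3 : w i * (τ / w i) = τ := by have := (hw i).ne'; field_simp
        have e4 : w i * ((u τ i j - z i j) / 2 - deficit N (y i) j *
            (Real.log (z i j + δ) + τ / w i - Real.log (z i j + δ)))
            = w i * (u τ i j - z i j) / 2 - deficit N (y i) j * (w i * (τ / w i)) := by ring
        rw [e4, e3]
        linarith
      · intro j _ hj
        have : u τ i j = z i j := if_neg hj
        rw [this, sub_self]
    have hsum : ∑ i, ∑ j ∈ A i, ((u τ i j + δ) / 2 - deficit N (y i) j) ≤ 0 := by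
      have hF : ∑ i, ∑ j ∈ A i, u τ i j ≤ m := by
        have h1 : ∑ i, ∑ j ∈ A i, u τ i j ≤ ∑ i, ∑ j ∈ occupied N z i, u τ i j :=
          Finset.sum_le_sum fun i _ => Finset.sum_le_sum_of_subset_of_nonneg (hAS i)
            fun j _ _ => (hz i j).1.trans (hu_le τ hτ i j)
        have h2 := hmass (u τ) (hu_out τ)
        rw [← Nat.cast_sum, hm] at h2
        push_cast at h2
        linarith
      have hA : ∑ i, ∑ j ∈ A i, δ ≤ m := by
        calc ∑ i, ∑ j ∈ A i, δ ≤ ∑ _i : M, (m : ℝ) * δ := by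
              refine Finset.sum_le_sum fun i _ => ?_
              rw [Finset.sum_const, nsmul_eq_mul]
              exact mul_le_mul_of_nonneg_right (by exact_mod_cast hAle i) hδ.le
          _ = m * (Fintype.card M * δ) := by
              rw [Finset.sum_const, Finset.card_univ, nsmul_eq_mul]; ring
          _ ≤ m := mul_le_of_le_one_right (Nat.cast_nonneg m) hδn
      have hD := le_sum_top_deficit (fun i => Finset.filter_subset _ _) hm hAcard hAS hAtop hy
      simp only [Finset.sum_sub_distrib, ← Finset.sum_div, Finset.sum_add_distrib]
      linarith
    have h3 := Finset.sum_le_sum fun i (_ : i ∈ Finset.univ) => hterm i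
    rw [Finset.sum_sub_distrib, ← Finset.mul_sum] at h3
    have h4 := mul_nonpos_of_nonneg_of_nonpos hτ hsum
    unfold slotPotentialSum
    linarith
  -- The first time at which a slot of `A` becomes empty.
  have hne : (Finset.univ.sigma A).Nonempty := by
    rw [Finset.nonempty_iff_ne_empty]
    intro h
    have hAe : ∀ i, A i = ∅ := by
      intro i
      rw [Finset.eq_empty_iff_forall_notMem]
      intro j hj
      have : (⟨i, j⟩ : Σ _ : M, ℕ) ∈ Finset.univ.sigma A := by simp [hj]
      rw [h] at this
      exact Finset.notMem_empty _ this
    have : ∀ i, (occupied N z i).card = 0 := by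
      intro i
      rcases hAcard i with h1 | h1
      · rw [hAe i, Finset.card_empty] at h1; omega
      · rw [← h1, hAe i, Finset.card_empty]
    rw [Finset.sum_congr rfl fun i _ => this i] at hlt
    simp at hlt
  set life : (Σ _ : M, ℕ) → ℝ := fun p =>
    w p.1 * (Real.log (1 + δ) - Real.log (z p.1 p.2 + δ)) with hlife
  obtain ⟨p, hp, hpmin⟩ := Finset.exists_min_image _ life hne
  have hpA : p.2 ∈ A p.1 := (Finset.mem_sigma.1 hp).2
  have hzδ : ∀ i j, 0 < z i j + δ := fun i j => by linarith [(hz i j).1]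
  have hT : 0 < life p := by
    refine mul_pos (hw _) (sub_pos.2 (Real.log_lt_log (hzδ _ _) ?_))
    linarith [hAz p.1 p.2 hpA]
  have hu1 : ∀ τ, τ ≤ life p → ∀ i j, u τ i j ≤ 1 := by
    intro τ hτ i j
    simp only [hu]
    split_ifs with hj
    · have h1 : τ ≤ life ⟨i, j⟩ := hτ.trans (hpmin ⟨i, j⟩ (by simp [hj]))
      have h2 : τ / w i ≤ Real.log (1 + δ) - Real.log (z i j + δ) := by
        rw [div_le_iff₀ (hw i), mul_comm]; exact h1
      have h3 : Real.exp (τ / w i) ≤ (1 + δ) / (z i j + δ) := by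
        rw [← Real.log_div (by linarith) (hzδ i j).ne'] at h2
        calc Real.exp (τ / w i) ≤ _ := Real.exp_le_exp.2 h2
          _ = _ := Real.exp_log (div_pos (by linarith) (hzδ i j))
      rw [le_div_iff₀ (hzδ i j)] at h3
      linarith
    · exact (hz i j).2
  by_cases hend : slotMass N (u (life p)) ≤ N
  · have hcont : Continuous fun τ => slotMass N (u τ) := by
      unfold slotMass
      refine continuous_finsetSum _ fun i _ => continuous_finsetSum _ fun j _ => ?_
      simp only [hu]
      split_ifs
      · fun_prop
      · fun_prop
    have hu0 : u 0 = z := by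
      funext i j; simp [hu]
    obtain ⟨τ, hτ, hτN⟩ := intermediate_value_Icc' hT.le hcont.continuousOn
      (show (N : ℝ) ∈ Set.Icc _ _ from ⟨hend, by simp only [hu0]; exact hN.le⟩)
    simp only at hτN
    exact ⟨u τ, fun i j => ⟨(hz i j).1.trans (hu_le τ hτ.1 i j), hu1 τ hτ.2 i j⟩, hu_le τ hτ.1,
      hτN.ge, Or.inl hτN, hpot τ hτ.1 hτN.ge⟩
  · push Not at hend
    refine ⟨u (life p), fun i j => ⟨(hz i j).1.trans (hu_le _ hT.le i j), hu1 _ le_rfl i j⟩,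
      hu_le _ hT.le, hend.le, Or.inr ?_, hpot _ hT.le hend.le⟩
    have hsub : ∀ i, occupied N (u (life p)) i ⊆ occupied N z i := by
      intro i j hj
      rw [occupied, Finset.mem_filter] at hj ⊢
      exact ⟨hj.1, (hu_le _ hT.le i j).trans_lt hj.2⟩
    refine Finset.sum_lt_sum (fun i _ => Finset.card_le_card (hsub i)) ⟨p.1, Finset.mem_univ _, ?_⟩
    refine Finset.card_lt_card ((Finset.ssubset_iff_of_subset (hsub p.1)).2
      ⟨p.2, hAS _ hpA, fun h => ?_⟩)
    have h1 : u (life p) p.1 p.2 = 1 := by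
      simp only [hu, if_pos hpA, hlife]
      rw [mul_div_cancel_left₀ _ (hw p.1).ne', Real.exp_sub, Real.exp_log (by linarith),
        Real.exp_log (hzδ _ _)]
      have := (hzδ p.1 p.2).ne'
      field_simp
      ring
    have h2 := (Finset.mem_filter.1 h).2
    rw [h1] at h2
    exact lt_irrefl _ h2

/-- Excess mass can be removed without increasing the potential against any offline allocation. -/
theorem exists_restore [Nonempty M] {w : M → ℝ} (hw : ∀ i, 0 < w i) {δ : ℝ} (hδ : 0 < δ)
    (hδn : Fintype.card M * δ ≤ 1) {N : ℕ} {z : M → ℕ → ℝ}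
    (hz : ∀ i j, z i j ∈ Set.Icc (0 : ℝ) 1) (hN : (N : ℝ) ≤ slotMass N z) :
    ∃ z' : M → ℕ → ℝ, (∀ i j, z' i j ∈ Set.Icc (0 : ℝ) 1) ∧ (∀ i j, z i j ≤ z' i j) ∧
      slotMass N z' = N ∧
      ∀ y ∈ stdSimplex ℝ M, slotPotentialSum w δ N z' y ≤ slotPotentialSum w δ N z y := by
  induction h : ∑ i, (occupied N z i).card using Nat.strong_induction_on generalizing z with
  | _ k ih =>
    rcases hN.eq_or_lt with he | hlt
    · exact ⟨z, hz, fun _ _ => le_rfl, he.symm, fun _ _ => le_rfl⟩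
    · obtain ⟨z', hz', hle, hN', hor, hpot⟩ := exists_partial_restore hw hδ hδn hz hlt
      rcases hor with he | hc
      · exact ⟨z', hz', hle, he, hpot⟩
      · obtain ⟨z'', hz'', hle', he, hpot'⟩ := ih _ (h ▸ hc) hz' hN' rfl
        exact ⟨z'', hz'', fun i j => (hle i j).trans (hle' i j), he,
          fun y hy => (hpot' y hy).trans (hpot y hy)⟩

/-! ### The slot dynamics -/

/-- The empty fractions `z i j` describe an allocation of one unit: `N` slots are filled in all. -/
structure IsProfile (N : ℕ) (z : M → ℕ → ℝ) : Prop where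
  pos : 0 < N
  mem : ∀ i j, z i j ∈ Set.Icc (0 : ℝ) 1
  mass : slotMass N z = N

/-- The allocation described by the empty fractions `z i j` of `N` slots at each point. -/
def slotAlloc (N : ℕ) (z : M → ℕ → ℝ) (i : M) : ℝ := (∑ j ∈ Finset.range N, (1 - z i j)) / N

theorem IsProfile.slotAlloc_mem {N : ℕ} {z : M → ℕ → ℝ} (h : IsProfile N z) :
    slotAlloc N z ∈ stdSimplex ℝ M := by
  have hN : (0 : ℝ) < N := by exact_mod_cast h.pos
  refine ⟨fun i => div_nonneg (Finset.sum_nonneg fun j _ => sub_nonneg.2 (h.mem i j).2) hN.le, ?_⟩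
  unfold slotAlloc
  rw [← Finset.sum_div, div_eq_one_iff_eq hN.ne']
  exact h.mass

/-- The potential of the online allocation against the offline allocation `y`. The sum of the slot
potentials bounds the cost of the algorithm up to the weighted mass in the second term, which turns
a bound on the upward movement into one on the whole movement. -/
def potential (w : M → ℝ) (δ : ℝ) (N : ℕ) (z : M → ℕ → ℝ) (y : M → ℝ) : ℝ :=
  8 * slotPotentialSum w δ N z y / N + ∑ i, w i * slotAlloc N z i

/-- Entropic descent on one slot under the force `g` of the request: `z + δ` shrinks by the factor
`exp (-g / w)`, and `z` stops at `0`. -/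
theorem exists_raise_slot {w δ z g : ℝ} (hw : 0 < w) (hδ : 0 < δ) (hz : z ∈ Set.Icc (0 : ℝ) 1)
    (hg : g ∈ Set.Icc 0 w) :
    ∃ v ∈ Set.Icc (0 : ℝ) 1, v ≤ z ∧ z * g ≤ 2 * (w * (z - v)) ∧
      ∀ a, 0 ≤ a → w * slotPotential δ v a - w * slotPotential δ z a
        ≤ a * g - w * (z - v) / 2 := by
  have hzδ : 0 < z + δ := by linarith [hz.1]
  have hs0 : 0 ≤ g / w := div_nonneg hg.1 hw.le
  have hs1 : g / w ≤ 1 := (div_le_one hw).2 hg.2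
  have hgs : g = w * (g / w) := by field_simp
  set s := g / w
  have hE0 := Real.exp_pos (-s)
  have hE1 : Real.exp (-s) ≤ 1 := Real.exp_le_one_iff.2 (by linarith)
  have hE2 : Real.exp (-s) ≤ 1 - s / 2 := by
    have h1 := Real.add_one_le_exp s
    have h2 : Real.exp (-s) * Real.exp s = 1 := by rw [← Real.exp_add]; simp
    nlinarith
  set v := max ((z + δ) * Real.exp (-s) - δ) 0 with hv
  have hv0 : 0 ≤ v := le_max_right _ _
  have hvz : v ≤ z := max_le (by nlinarith) hz.1
  refine ⟨v, ⟨hv0, hvz.trans hz.2⟩, hvz, ?_, ?_⟩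
  · have h1 : z * s ≤ 2 * (z - v) := by
      rcases max_choice ((z + δ) * Real.exp (-s) - δ) 0 with h | h
      · rw [hv, h]; nlinarith [hz.1]
      · rw [hv, h]; nlinarith [hz.1]
    rw [hgs]
    nlinarith
  · intro a ha
    have h1 : Real.log (z + δ) - s ≤ Real.log (v + δ) := by
      have : Real.log ((z + δ) * Real.exp (-s)) ≤ Real.log (v + δ) :=
        Real.log_le_log (by positivity) (by linarith [le_max_left ((z + δ) * Real.exp (-s) - δ) 0])
      rwa [Real.log_mul hzδ.ne' hE0.ne', Real.log_exp, ← sub_eq_add_neg] at this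
    rw [← mul_sub, slotPotential_sub hδ hz.1 hv0]
    have h2 : a * (Real.log (z + δ) - Real.log (v + δ)) ≤ a * s :=
      mul_le_mul_of_nonneg_left (by linarith) ha
    have h3 := mul_le_mul_of_nonneg_left h2 hw.le
    have h4 : a * g = w * (a * s) := by
      calc a * g = a * (w * s) := by rw [← hgs]
        _ = _ := by ring
    rw [h4]
    nlinarith

/-- One step of the online dynamics under small forces `g`: the movement plus the linearized service
cost before the step is paid for by the offline cost and the decrease of the potential. -/
theorem exists_substep [Nonempty M] {w : M → ℝ} (hw : ∀ i, 0 < w i) {δ : ℝ} (hδ : 0 < δ)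
    (hδn : Fintype.card M * δ ≤ 1) {N : ℕ} {z : M → ℕ → ℝ} (hz : IsProfile N z)
    {g : M → ℕ → ℝ} (hg : ∀ i j, g i j ∈ Set.Icc 0 (w i)) :
    ∃ z' : M → ℕ → ℝ, IsProfile N z' ∧ ∀ y ∈ stdSimplex ℝ M,
      weightedDist w (slotAlloc N z) (slotAlloc N z')
          + (∑ i, ∑ j ∈ Finset.range N, z i j * g i j) / N
        ≤ 8 * ((∑ i, ∑ j ∈ Finset.range N, deficit N (y i) j * g i j) / N)
          + (potential w δ N z y - potential w δ N z' y) := by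
  choose v hv hvz hvg hvpot using fun i j => exists_raise_slot (hw i) hδ (hz.mem i j) (hg i j)
  have hmass : (N : ℝ) ≤ slotMass N v := by
    rw [← hz.mass]
    exact Finset.sum_le_sum fun i _ => Finset.sum_le_sum fun j _ => by linarith [hvz i j]
  obtain ⟨z', hz', hvz', hN', hpot⟩ := exists_restore hw hδ hδn hv hmass
  have hN : (0 : ℝ) < N := by exact_mod_cast hz.pos
  refine ⟨z', ⟨hz.pos, hz', hN'⟩, fun y hy => ?_⟩
  set U : ℝ := ∑ i, ∑ j ∈ Finset.range N, w i * (z i j - v i j) with hU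
  have h1 : ∑ i, ∑ j ∈ Finset.range N, z i j * g i j ≤ 2 * U := by
    rw [hU, Finset.mul_sum]
    refine Finset.sum_le_sum fun i _ => ?_
    rw [Finset.mul_sum]
    exact Finset.sum_le_sum fun j _ => hvg i j
  have h2 : slotPotentialSum w δ N v y - slotPotentialSum w δ N z y
      ≤ ∑ i, ∑ j ∈ Finset.range N, deficit N (y i) j * g i j - U / 2 := by
    rw [hU, slotPotentialSum, slotPotentialSum, ← Finset.sum_sub_distrib, Finset.sum_div,
      ← Finset.sum_sub_distrib]
    refine Finset.sum_le_sum fun i _ => ?_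
    rw [Finset.mul_sum, Finset.mul_sum, ← Finset.sum_sub_distrib, Finset.sum_div,
      ← Finset.sum_sub_distrib]
    exact Finset.sum_le_sum fun j _ => hvpot i j _ (deficit_nonneg _ _ _)
  have h3 : weightedDist w (slotAlloc N z) (slotAlloc N z') * N
      ≤ 2 * U + (∑ i, w i * slotAlloc N z i - ∑ i, w i * slotAlloc N z' i) * N := by
    rw [hU, weightedDist, ← Finset.sum_sub_distrib, Finset.sum_mul, Finset.sum_mul, Finset.mul_sum,
      ← Finset.sum_add_distrib]
    refine Finset.sum_le_sum fun i _ => ?_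
    have e1 : (slotAlloc N z i - slotAlloc N z' i) * N
        = ∑ j ∈ Finset.range N, (z' i j - z i j) := by
      unfold slotAlloc
      rw [← sub_div, div_mul_cancel₀ _ hN.ne', ← Finset.sum_sub_distrib]
      exact Finset.sum_congr rfl fun j _ => by ring
    have e2 : |slotAlloc N z i - slotAlloc N z' i| * N
        ≤ ∑ j ∈ Finset.range N, (2 * (z i j - v i j) + (z' i j - z i j)) := by
      have e0 : |slotAlloc N z i - slotAlloc N z' i| * N
          = |(slotAlloc N z i - slotAlloc N z' i) * N| := by rw [abs_mul, abs_of_pos hN]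
      rw [e0, e1]
      refine (Finset.abs_sum_le_sum_abs _ _).trans (Finset.sum_le_sum fun j _ => ?_)
      rw [abs_le]
      constructor <;> linarith [hvz i j, hvz' i j]
    rw [Finset.sum_add_distrib, ← e1, ← Finset.mul_sum] at e2
    rw [← Finset.mul_sum]
    have e3 := mul_le_mul_of_nonneg_left e2 (hw i).le
    calc _ = w i * (|slotAlloc N z i - slotAlloc N z' i| * N) := by ring
      _ ≤ _ := e3
      _ = _ := by ring
  have h4 := hpot y hy
  unfold potential
  have h5 : weightedDist w (slotAlloc N z) (slotAlloc N z') * N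
      + ∑ i, ∑ j ∈ Finset.range N, z i j * g i j
      ≤ 8 * ∑ i, ∑ j ∈ Finset.range N, deficit N (y i) j * g i j
        + 8 * (slotPotentialSum w δ N z y - slotPotentialSum w δ N z' y)
        + (∑ i, w i * slotAlloc N z i - ∑ i, w i * slotAlloc N z' i) * N := by linarith
  have h6 := div_le_div_of_nonneg_right h5 hN.le
  rw [add_div, add_div, add_div, mul_div_cancel_right₀ _ hN.ne', mul_div_cancel_right₀ _ hN.ne'] at h6
  calc _ ≤ _ := h6
    _ = _ := by ring

/-- Among `K` steps under the same forces there is one whose service cost is at most the average. -/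
theorem exists_best_substep [Nonempty M] {w : M → ℝ} (hw : ∀ i, 0 < w i) {δ : ℝ} (hδ : 0 < δ)
    (hδn : Fintype.card M * δ ≤ 1) {N : ℕ} {z : M → ℕ → ℝ} (hz : IsProfile N z)
    {g : M → ℕ → ℝ} (hg : ∀ i j, g i j ∈ Set.Icc 0 (w i)) (K : ℕ) :
    ∃ b z' : M → ℕ → ℝ, IsProfile N b ∧ IsProfile N z' ∧ ∀ y ∈ stdSimplex ℝ M,
      weightedDist w (slotAlloc N z) (slotAlloc N b)
          + weightedDist w (slotAlloc N b) (slotAlloc N z')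
          + K * ((∑ i, ∑ j ∈ Finset.range N, b i j * g i j) / N)
        ≤ K * (8 * ((∑ i, ∑ j ∈ Finset.range N, deficit N (y i) j * g i j) / N))
          + (potential w δ N z y - potential w δ N z' y) := by
  induction K with
  | zero => exact ⟨z, z, hz, hz, fun y _ => by simp [weightedDist_self]⟩
  | succ K ih =>
    obtain ⟨b, z', hb, hz', h⟩ := ih
    obtain ⟨z'', hz'', h'⟩ := exists_substep hw hδ hδn hz' hg
    have hw' : ∀ i, 0 ≤ w i := fun i => (hw i).le
    have hK : (0 : ℝ) ≤ K := Nat.cast_nonneg K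
    rcases le_total ((∑ i, ∑ j ∈ Finset.range N, z' i j * g i j) / N)
      ((∑ i, ∑ j ∈ Finset.range N, b i j * g i j) / N) with hc | hc
    · refine ⟨z', z'', hz', hz'', fun y hy => ?_⟩
      have h1 := h y hy
      have h2 := h' y hy
      have h3 := weightedDist_triangle hw' (slotAlloc N z) (slotAlloc N b) (slotAlloc N z')
      have h4 := mul_le_mul_of_nonneg_left hc hK
      push_cast
      linarith
    · refine ⟨b, z'', hb, hz'', fun y hy => ?_⟩
      have h1 := h y hy
      have h2 := h' y hy
      have h3 := weightedDist_triangle hw' (slotAlloc N b) (slotAlloc N z') (slotAlloc N z'')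
      push_cast
      linarith

/-! ### Refinement of the slots -/

theorem sum_range_mul {E : Type*} [AddCommMonoid E] (N R : ℕ) (f : ℕ → E) :
    ∑ j ∈ Finset.range (N * R), f j
      = ∑ j ∈ Finset.range N, ∑ k ∈ Finset.range R, f (j * R + k) := by
  induction N with
  | zero => simp
  | succ N ih => rw [add_mul, one_mul, Finset.sum_range_add, ih, Finset.sum_range_succ]

/-- Every slot is cut into `R` slots with the same empty fraction. -/
def refineSlots {ι : Type*} (R : ℕ) (z : ι → ℕ → ℝ) : ι → ℕ → ℝ := fun i j => z i (j / R)

theorem refineSlots_apply {ι : Type*} {R : ℕ} (z : ι → ℕ → ℝ) (i : ι) (j : ℕ) {k : ℕ}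
    (hk : k ∈ Finset.range R) : refineSlots R z i (j * R + k) = z i j := by
  have hk' := Finset.mem_range.1 hk
  unfold refineSlots
  rw [mul_comm, Nat.mul_add_div (by omega), Nat.div_eq_of_lt hk', add_zero]

theorem sum_refineSlots {ι : Type*} {R : ℕ} (N : ℕ) (z : ι → ℕ → ℝ) (i : ι) :
    ∑ j ∈ Finset.range (N * R), (1 - refineSlots R z i j)
      = R * ∑ j ∈ Finset.range N, (1 - z i j) := by
  rw [sum_range_mul, Finset.mul_sum]
  refine Finset.sum_congr rfl fun j _ => ?_
  rw [Finset.sum_congr rfl fun k hk => by rw [refineSlots_apply z i j hk]]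
  rw [Finset.sum_const, Finset.card_range, nsmul_eq_mul]

theorem IsProfile.refineSlots {N R : ℕ} (hR : 0 < R) {z : M → ℕ → ℝ} (h : IsProfile N z) :
    IsProfile (N * R) (refineSlots R z) := by
  refine ⟨Nat.mul_pos h.pos hR, fun i j => h.mem _ _, ?_⟩
  unfold slotMass
  simp only [sum_refineSlots]
  rw [← Finset.mul_sum]
  have := h.mass
  unfold slotMass at this
  rw [this]; push_cast; ring

theorem slotAlloc_refineSlots {ι : Type*} {N R : ℕ} (hR : 0 < R) (z : ι → ℕ → ℝ) :
    slotAlloc (N * R) (refineSlots R z) = slotAlloc N z := by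
  have hR' : (R : ℝ) ≠ 0 := by positivity
  funext i
  unfold slotAlloc
  rw [sum_refineSlots, Nat.cast_mul, mul_comm (N : ℝ), mul_div_mul_left _ _ hR']

/-- The potential is linear in the offline deficits, so that refining the slots preserves it. -/
theorem potential_refineSlots {N R : ℕ} (hR : 0 < R) (w : M → ℝ) (δ : ℝ) (z : M → ℕ → ℝ) (y : M → ℝ) :
    potential w δ (N * R) (refineSlots R z) y = potential w δ N z y := by
  have hR' : (R : ℝ) ≠ 0 := by positivity
  have h1 : slotPotentialSum w δ (N * R) (refineSlots R z) y = R * slotPotentialSum w δ N z y := by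
    unfold slotPotentialSum
    rw [Finset.mul_sum]
    refine Finset.sum_congr rfl fun i _ => ?_
    rw [sum_range_mul, mul_left_comm, Finset.mul_sum _ _ (R : ℝ)]
    congr 1
    refine Finset.sum_congr rfl fun j _ => ?_
    rw [Finset.sum_congr rfl fun k hk => by rw [refineSlots_apply z i j hk]]
    unfold slotPotential
    rw [Finset.sum_sub_distrib, ← Finset.sum_mul, sum_deficit_refine hR]
    simp only [Finset.sum_const, Finset.card_range, nsmul_eq_mul]
    ring
  unfold potential
  rw [slotAlloc_refineSlots hR, h1, Nat.cast_mul, mul_comm (N : ℝ), mul_left_comm,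
    mul_div_mul_left _ _ hR']

/-! ### Bounds on the potential -/

theorem potential_nonneg {w : M → ℝ} (hw : ∀ i, 0 < w i) {δ : ℝ} (hδ : 0 < δ) {N : ℕ}
    {z : M → ℕ → ℝ} (hz : IsProfile N z) (y : M → ℝ) : 0 ≤ potential w δ N z y := by
  have h1 : 0 ≤ slotPotentialSum w δ N z y :=
    Finset.sum_nonneg fun i _ => mul_nonneg (hw i).le (Finset.sum_nonneg fun j _ =>
      slotPotential_nonneg hδ (hz.mem i j) (deficit_nonneg _ _ _))
  have h2 : 0 ≤ ∑ i, w i * slotAlloc N z i :=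
    Finset.sum_nonneg fun i _ => mul_nonneg (hw i).le (hz.slotAlloc_mem.1 i)
  unfold potential
  positivity

theorem le_one_of_mem_stdSimplex {y : M → ℝ} (hy : y ∈ stdSimplex ℝ M) (i : M) : y i ≤ 1 := by
  rw [← hy.2]
  exact Finset.single_le_sum (fun i _ => hy.1 i) (Finset.mem_univ i)

theorem potential_le {w : M → ℝ} (hw : ∀ i, 0 < w i) {δ : ℝ} (hδ : 0 < δ) {N : ℕ}
    {z : M → ℕ → ℝ} (hz : IsProfile N z) (y : M → ℝ) :
    potential w δ N z y ≤ (8 * (1 + Real.log ((1 + δ) / δ)) + 1) * ∑ i, w i := by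
  have hN : (0 : ℝ) < N := by exact_mod_cast hz.pos
  have hslot : ∀ i j, slotPotential δ (z i j) (deficit N (y i) j)
      ≤ 1 + Real.log ((1 + δ) / δ) := by
    intro i j
    have h1 := neg_log_le hδ (hz.mem i j)
    have h0 : 0 ≤ Real.log ((1 + δ) / δ) :=
      Real.log_nonneg ((one_le_div hδ).2 (by linarith))
    have ha0 := deficit_nonneg N (y i) j
    have ha1 := deficit_le_one N (y i) j
    unfold slotPotential
    have h2 := mul_le_mul_of_nonneg_left h1 ha0
    have h3 := mul_le_mul_of_nonneg_right ha1 h0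
    linarith [(hz.mem i j).2]
  have h1 : slotPotentialSum w δ N z y ≤ N * ((1 + Real.log ((1 + δ) / δ)) * ∑ i, w i) := by
    unfold slotPotentialSum
    rw [Finset.mul_sum, Finset.mul_sum]
    refine Finset.sum_le_sum fun i _ => ?_
    have := Finset.sum_le_sum fun j (_ : j ∈ Finset.range N) => hslot i j
    rw [Finset.sum_const, Finset.card_range, nsmul_eq_mul] at this
    calc _ ≤ _ := mul_le_mul_of_nonneg_left this (hw i).le
      _ = _ := by ring
  have h2 : ∑ i, w i * slotAlloc N z i ≤ ∑ i, w i := Finset.sum_le_sum fun i _ =>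
    mul_le_of_le_one_right (hw i).le (le_one_of_mem_stdSimplex hz.slotAlloc_mem i)
  have h3 : 8 * slotPotentialSum w δ N z y / N ≤ 8 * ((1 + Real.log ((1 + δ) / δ)) * ∑ i, w i) := by
    rw [div_le_iff₀ hN]; linarith
  unfold potential
  linarith

/-- An offline movement raises the potential by at most `O(log (1 / δ))` times its cost. -/
theorem potential_le_add {w : M → ℝ} (hw : ∀ i, 0 < w i) {δ : ℝ} (hδ : 0 < δ) {N : ℕ}
    {z : M → ℕ → ℝ} (hz : IsProfile N z) {y y' : M → ℝ} (hy : y ∈ stdSimplex ℝ M)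
    (hy' : y' ∈ stdSimplex ℝ M) :
    potential w δ N z y' ≤ potential w δ N z y
      + 8 * Real.log ((1 + δ) / δ) * weightedDist w y y' := by
  have hN : (0 : ℝ) < N := by exact_mod_cast hz.pos
  set Λ := Real.log ((1 + δ) / δ) with hΛ
  have hΛ0 : 0 ≤ Λ := Real.log_nonneg ((one_le_div hδ).2 (by linarith))
  have hslot : ∀ i j, slotPotential δ (z i j) (deficit N (y' i) j)
      - slotPotential δ (z i j) (deficit N (y i) j)
      ≤ Λ * |deficit N (y' i) j - deficit N (y i) j| := by
    intro i j
    have h1 := neg_log_le hδ (hz.mem i j)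
    have h2 : 0 ≤ -Real.log ((z i j + δ) / (1 + δ)) := by
      rw [neg_nonneg]
      apply Real.log_nonpos
      · have := (hz.mem i j).1; positivity
      · rw [div_le_one (by linarith)]; linarith [(hz.mem i j).2]
    calc _ = -Real.log ((z i j + δ) / (1 + δ)) * (deficit N (y' i) j - deficit N (y i) j) := by
          unfold slotPotential; ring
      _ ≤ -Real.log ((z i j + δ) / (1 + δ)) * |deficit N (y' i) j - deficit N (y i) j| :=
          mul_le_mul_of_nonneg_left (le_abs_self _) h2
      _ ≤ _ := mul_le_mul_of_nonneg_right h1 (abs_nonneg _)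
  -- The differences of the deficits at one point all have the same sign.
  have habs : ∀ i, ∑ j ∈ Finset.range N, |deficit N (y' i) j - deficit N (y i) j|
      = N * |y i - y' i| := by
    intro i
    have s1 := sum_deficit (N := N) (hy.1 i) (le_one_of_mem_stdSimplex hy i)
    have s2 := sum_deficit (N := N) (hy'.1 i) (le_one_of_mem_stdSimplex hy' i)
    rcases le_total (y i) (y' i) with h | h
    · rw [Finset.sum_congr rfl fun j _ =>
        abs_of_nonpos (sub_nonpos.2 (deficit_antitone N j h)), Finset.sum_neg_distrib,
        Finset.sum_sub_distrib, s1, s2, abs_of_nonpos (by linarith)]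
      ring
    · rw [Finset.sum_congr rfl fun j _ =>
        abs_of_nonneg (sub_nonneg.2 (deficit_antitone N j h)),
        Finset.sum_sub_distrib, s1, s2, abs_of_nonneg (by linarith)]
      ring
  have h1 : slotPotentialSum w δ N z y' - slotPotentialSum w δ N z y
      ≤ N * (Λ * weightedDist w y y') := by
    unfold slotPotentialSum weightedDist
    rw [← Finset.sum_sub_distrib, Finset.mul_sum, Finset.mul_sum]
    refine Finset.sum_le_sum fun i _ => ?_
    rw [← mul_sub, ← Finset.sum_sub_distrib]
    have h2 := Finset.sum_le_sum fun j (_ : j ∈ Finset.range N) => hslot i j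
    rw [← Finset.mul_sum, habs i] at h2
    calc _ ≤ _ := mul_le_mul_of_nonneg_left h2 (hw i).le
      _ = _ := by ring
  have h3 : 8 * slotPotentialSum w δ N z y' / N
      ≤ 8 * slotPotentialSum w δ N z y / N + 8 * Λ * weightedDist w y y' := by
    rw [div_add' _ _ _ hN.ne', div_le_div_iff_of_pos_right hN]
    linarith
  unfold potential
  linarith

/-! ### Convex costs on slots -/

theorem convexOn_add_le_add {f : ℝ → ℝ} {S : Set ℝ} (hf : ConvexOn ℝ S f) {s t h : ℝ} (hs : s ∈ S)
    (hth : t + h ∈ S) (hst : s ≤ t) (hh : 0 ≤ h) : f (s + h) + f t ≤ f s + f (t + h) := by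
  rcases (add_nonneg (sub_nonneg.2 hst) hh).eq_or_lt with h0 | h0
  · have h1 : h = 0 := by linarith
    subst h1; simp
  · set d := t - s + h with hd
    have e1 : (t - s) / d + h / d = 1 := by field_simp; linarith
    have hp : 0 ≤ (t - s) / d := div_nonneg (by linarith) h0.le
    have hq : 0 ≤ h / d := div_nonneg hh h0.le
    have c1 := hf.2 hs hth hp hq e1
    have c2 := hf.2 hs hth hq hp (by linarith)
    simp only [smul_eq_mul] at c1 c2
    have x1 : (t - s) / d * s + h / d * (t + h) = s + h := by
      field_simp; rw [hd]; ring
    have x2 : h / d * s + (t - s) / d * (t + h) = t := by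
      field_simp; rw [hd]; ring
    rw [x1] at c1
    rw [x2] at c2
    have e2 : (t - s) / d = 1 - h / d := by linarith
    rw [e2] at c1 c2
    linarith

/-- The cost of an allocation is at most its linearized cost over the slots: the marginal costs
`f (j / N) - f ((j + 1) / N)` decrease in `j`, so that filling the slots from below is best. -/
theorem convexOn_le_sum_slots {f : ℝ → ℝ} (hf : ConvexOn ℝ (Set.Icc 0 1) f) {N : ℕ} {z : ℕ → ℝ}
    (hz : ∀ j, z j ∈ Set.Icc (0 : ℝ) 1) {k : ℕ} (hk : k ≤ N) :
    f ((∑ j ∈ Finset.range k, (1 - z j)) / N)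
      ≤ f ((k : ℝ) / N) + ∑ j ∈ Finset.range k, z j * (f ((j : ℝ) / N) - f (((j : ℝ) + 1) / N)) := by
  induction k with
  | zero => simp
  | succ k ih =>
    have hN : (0 : ℝ) < N := by exact_mod_cast (Nat.succ_pos k).trans_le hk
    have hkN : (k : ℝ) + 1 ≤ N := by exact_mod_cast hk
    have ih' := ih (Nat.le_of_succ_le hk)
    have hsum0 : 0 ≤ ∑ j ∈ Finset.range k, (1 - z j) :=
      Finset.sum_nonneg fun j _ => sub_nonneg.2 (hz j).2
    have hsumk : ∑ j ∈ Finset.range k, (1 - z j) ≤ k := by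
      have := Finset.sum_le_sum fun j (_ : j ∈ Finset.range k) =>
        (show 1 - z j ≤ 1 by linarith [(hz j).1])
      simpa using this
    rw [Finset.sum_range_succ, Finset.sum_range_succ]
    push_cast
    set s := (∑ j ∈ Finset.range k, (1 - z j)) / N with hs
    have hzk := hz k
    have hk0 : (0 : ℝ) ≤ k := Nat.cast_nonneg k
    have m1 : s ∈ Set.Icc (0 : ℝ) 1 :=
      ⟨div_nonneg hsum0 hN.le, (div_le_one hN).2 (by linarith)⟩
    have m2 : (k : ℝ) / N ∈ Set.Icc (0 : ℝ) 1 :=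
      ⟨div_nonneg hk0 hN.le, (div_le_one hN).2 (by linarith)⟩
    have m3 : ((k : ℝ) + 1) / N ∈ Set.Icc (0 : ℝ) 1 :=
      ⟨div_nonneg (by linarith) hN.le, (div_le_one hN).2 hkN⟩
    have m4 : (k : ℝ) / N + (1 - z k) / N ∈ Set.Icc (0 : ℝ) 1 := by
      rw [← add_div]
      exact ⟨div_nonneg (by linarith [hzk.2]) hN.le, (div_le_one hN).2 (by linarith [hzk.1])⟩
    have a1 := convexOn_add_le_add hf m1 m4 (div_le_div_of_nonneg_right hsumk hN.le)
      (div_nonneg (by linarith [hzk.2]) hN.le)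
    have a2 := hf.2 m2 m3 hzk.1 (show 0 ≤ 1 - z k by linarith [hzk.2]) (by ring)
    simp only [smul_eq_mul] at a2
    have e1 : z k * ((k : ℝ) / N) + (1 - z k) * (((k : ℝ) + 1) / N)
        = (k : ℝ) / N + (1 - z k) / N := by ring
    rw [e1] at a2
    rw [add_div, ← hs]
    linarith

/-- For an allocation that fills the slots from below, the linearized cost is close to the cost. -/
theorem sum_deficit_mul_le {f : ℝ → ℝ} (hf : AntitoneOn f (Set.Icc 0 1)) {L : ℝ} (hL0 : 0 ≤ L)
    (hL : ∀ a ∈ Set.Icc (0 : ℝ) 1, ∀ b ∈ Set.Icc (0 : ℝ) 1, a ≤ b → f a - f b ≤ L * (b - a))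
    {N : ℕ} (hN : 0 < N) {y : ℝ} (hy : y ∈ Set.Icc (0 : ℝ) 1) :
    ∑ j ∈ Finset.range N, deficit N y j * (f ((j : ℝ) / N) - f (((j : ℝ) + 1) / N))
      ≤ f y + L / N - f 1 := by
  have hN' : (0 : ℝ) < N := by exact_mod_cast hN
  have hLN : 0 ≤ L / N := div_nonneg hL0 hN'.le
  set ψ : ℕ → ℝ := fun j => min (f ((j : ℝ) / N)) (f y + L / N) with hψ
  have hterm : ∀ j ∈ Finset.range N,
      deficit N y j * (f ((j : ℝ) / N) - f (((j : ℝ) + 1) / N)) ≤ ψ j - ψ (j + 1) := by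
    intro j hj
    have hj' : (j : ℝ) + 1 ≤ N := by exact_mod_cast Finset.mem_range.1 hj
    have hj0 : (0 : ℝ) ≤ j := Nat.cast_nonneg j
    have m2 : (j : ℝ) / N ∈ Set.Icc (0 : ℝ) 1 :=
      ⟨div_nonneg hj0 hN'.le, (div_le_one hN').2 (by linarith)⟩
    have m3 : ((j : ℝ) + 1) / N ∈ Set.Icc (0 : ℝ) 1 :=
      ⟨div_nonneg (by linarith) hN'.le, (div_le_one hN').2 hj'⟩
    have hle : (j : ℝ) / N ≤ ((j : ℝ) + 1) / N := div_le_div_of_nonneg_right (by linarith) hN'.le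
    have hmono := hf m2 m3 hle
    simp only [hψ]
    push_cast
    rcases le_or_gt ((j : ℝ) + 1) (N * y) with h | h
    · rw [deficit_eq_zero h, zero_mul]
      exact sub_nonneg.2 (min_le_min hmono le_rfl)
    · have h1 : f ((j : ℝ) / N) ≤ f y + L / N := by
        rcases le_total y ((j : ℝ) / N) with h2 | h2
        · linarith [hf hy m2 h2]
        · have h3 := hL _ m2 _ hy h2
          have h4 : y - (j : ℝ) / N ≤ 1 / N := by
            rw [sub_le_iff_le_add, ← add_div, le_div_iff₀ hN']
            linarith
          have h5 := mul_le_mul_of_nonneg_left h4 hL0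
          rw [mul_one_div] at h5
          linarith
      rw [min_eq_left h1]
      have h2 := mul_le_mul_of_nonneg_right (deficit_le_one N y j) (sub_nonneg.2 hmono)
      have h3 := min_le_left (f (((j : ℝ) + 1) / N)) (f y + L / N)
      linarith
  have hsum := Finset.sum_le_sum hterm
  rw [Finset.sum_range_sub'] at hsum
  have h0 : ψ 0 ≤ f y + L / N := min_le_right _ _
  have h1 : ψ N = f 1 := by
    simp only [hψ]
    rw [div_self hN'.ne']
    exact min_eq_left (by linarith [hf hy (Set.right_mem_Icc.2 zero_le_one) hy.2])
  linarith

/-! ### Mixing with the uniform allocation -/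

/-- The cost of the allocation `s` after it has been mixed with the amount `u`. -/
def CostFunction.mix (c : CostFunction) (η u s : ℝ) : ℝ := c.toFun ((1 - η) * s + η * u)

theorem mix_mem {η u s : ℝ} (hη : η ∈ Set.Ioo (0 : ℝ) 1) (hu : u ∈ Set.Ioc (0 : ℝ) 1)
    (hs : s ∈ Set.Icc (0 : ℝ) 1) : (1 - η) * s + η * u ∈ Set.Icc (0 : ℝ) 1 := by
  obtain ⟨h1, h2⟩ := hη
  obtain ⟨h3, h4⟩ := hu
  obtain ⟨h5, h6⟩ := hs
  constructor <;> nlinarith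

theorem CostFunction.mix_antitoneOn (c : CostFunction) {η u : ℝ} (hη : η ∈ Set.Ioo (0 : ℝ) 1)
    (hu : u ∈ Set.Ioc (0 : ℝ) 1) : AntitoneOn (c.mix η u) (Set.Icc 0 1) := by
  intro a ha b hb hab
  refine c.antitone (mix_mem hη hu ha) (mix_mem hη hu hb) ?_
  nlinarith [hη.2]

theorem CostFunction.mix_convexOn (c : CostFunction) {η u : ℝ} (hη : η ∈ Set.Ioo (0 : ℝ) 1)
    (hu : u ∈ Set.Ioc (0 : ℝ) 1) : ConvexOn ℝ (Set.Icc 0 1) (c.mix η u) := by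
  refine ⟨convex_Icc 0 1, fun a ha b hb p q hp hq hpq => ?_⟩
  have h := c.convex.2 (mix_mem hη hu ha) (mix_mem hη hu hb) hp hq hpq
  have e : p • ((1 - η) * a + η * u) + q • ((1 - η) * b + η * u)
      = (1 - η) * (p • a + q • b) + η * u := by
    simp only [smul_eq_mul]
    linear_combination η * u * hpq
  rw [e] at h
  exact h

theorem CostFunction.mix_le (c : CostFunction) {η u s : ℝ} (hη : η ∈ Set.Ioo (0 : ℝ) 1)
    (hu : u ∈ Set.Ioc (0 : ℝ) 1) (hs : s ∈ Set.Icc (0 : ℝ) 1) :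
    c.mix η u s ≤ c.toFun s + η * c.toFun u := by
  have h := c.convex.2 hs ⟨hu.1.le, hu.2⟩ (show 0 ≤ 1 - η by linarith [hη.2]) hη.1.le (by ring)
  simp only [smul_eq_mul] at h
  unfold mix
  nlinarith [c.nonneg s hs, hη.1]

/-- The mixed argument stays away from `0`, the only point of `[0, 1]` near which a non-increasing
convex function can be steep. -/
theorem CostFunction.mix_sub_le (c : CostFunction) {η u : ℝ} (hη : η ∈ Set.Ioo (0 : ℝ) 1)
    (hu : u ∈ Set.Ioc (0 : ℝ) 1) {a : ℝ} (ha : a ∈ Set.Icc (0 : ℝ) 1) {b : ℝ}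
    (hb : b ∈ Set.Icc (0 : ℝ) 1) (hab : a ≤ b) :
    c.mix η u a - c.mix η u b ≤ c.toFun 0 / (η * u) * (b - a) := by
  have hp := mix_mem hη hu ha
  have hq := mix_mem hη hu hb
  have h0 : (0 : ℝ) ∈ Set.Icc (0 : ℝ) 1 := ⟨le_rfl, zero_le_one⟩
  unfold mix
  have hηu : 0 < η * u := mul_pos hη.1 hu.1
  have hpu : η * u ≤ (1 - η) * a + η * u := by nlinarith [ha.1, hη.2]
  have hpq : (1 - η) * a + η * u ≤ (1 - η) * b + η * u := by nlinarith [hη.2]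
  have hd : ((1 - η) * b + η * u) - ((1 - η) * a + η * u) ≤ b - a := by nlinarith [hη.1]
  set p := (1 - η) * a + η * u
  set q := (1 - η) * b + η * u
  have hq0 : 0 < q := by linarith
  have hc := c.convex.2 h0 hq (show 0 ≤ (q - p) / q from div_nonneg (by linarith) hq0.le)
    (show 0 ≤ p / q from div_nonneg hp.1 hq0.le) (by field_simp; ring)
  simp only [smul_eq_mul, mul_zero, zero_add] at hc
  rw [div_mul_cancel₀ _ hq0.ne'] at hc
  have e : p / q = 1 - (q - p) / q := by field_simp; ring
  rw [e] at hc
  have hr : (q - p) / q ≤ (b - a) / (η * u) :=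
    div_le_div₀ (by linarith) hd hηu (by linarith)
  have hr0 : 0 ≤ (q - p) / q := div_nonneg (by linarith) hq0.le
  have h1 := mul_le_mul_of_nonneg_right hr (c.nonneg 0 h0)
  have h2 := mul_nonneg hr0 (c.nonneg q hq)
  have e2 : c.toFun 0 / (η * u) * (b - a) = (b - a) / (η * u) * c.toFun 0 := by ring
  rw [e2]
  linarith

/-! ### One time step -/

theorem serviceCost_nonneg (c : Request M) (x : Allocation M) : 0 ≤ serviceCost c x :=
  Finset.sum_nonneg fun i _ => (c i).nonneg _ ⟨x.2.1 i, le_one_of_mem_stdSimplex x.2 i⟩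

/-- One time step: the movement to the new position `X` and on to the new state of the dynamics,
plus the service cost in `X`, is paid for by the offline cost and the decrease of the potential, up
to an arbitrarily small error. The position `X` is a mixture of a state of the dynamics and the
uniform allocation; this makes the costs Lipschitz, so that they can be linearized over slots. -/
theorem exists_step [Nonempty M] {w : M → ℝ} (hw : ∀ i, 0 < w i) {N : ℕ} {z : M → ℕ → ℝ}
    (hz : IsProfile N z) (c : Request M) {e : ℝ} (he : 0 < e) :
    ∃ (X : Allocation M) (N' : ℕ) (z' : M → ℕ → ℝ), IsProfile N' z' ∧ ∀ y : Allocation M,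
      weightedDist w (slotAlloc N z) X.1 + weightedDist w X.1 (slotAlloc N' z') + serviceCost c X
        ≤ 8 * serviceCost c y + (potential w (1 / Fintype.card M) N z y.1
          - potential w (1 / Fintype.card M) N' z' y.1) + e := by
  set u : ℝ := 1 / Fintype.card M with hu_def
  have hn : (0 : ℝ) < Fintype.card M := by exact_mod_cast Fintype.card_pos
  have hn1 : (1 : ℝ) ≤ Fintype.card M := by exact_mod_cast Fintype.card_pos
  have hu : u ∈ Set.Ioc (0 : ℝ) 1 := ⟨by positivity, (div_le_one hn).2 hn1⟩
  have hnu : Fintype.card M * u ≤ 1 := by rw [hu_def, mul_one_div_cancel hn.ne']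
  have hsum_u : ∑ _i : M, u = 1 := by
    rw [Finset.sum_const, Finset.card_univ, nsmul_eq_mul, hu_def, mul_one_div_cancel hn.ne']
  have m0 : (0 : ℝ) ∈ Set.Icc (0 : ℝ) 1 := ⟨le_rfl, zero_le_one⟩
  set s : ℝ := ∑ i, (c i).toFun u
  have hs : 0 ≤ s := Finset.sum_nonneg fun i _ => (c i).nonneg u ⟨hu.1.le, hu.2⟩
  set W : ℝ := ∑ i, w i
  have hW : 0 ≤ W := Finset.sum_nonneg fun i _ => (hw i).le
  obtain ⟨η, hη, hηe⟩ : ∃ η ∈ Set.Ioo (0 : ℝ) 1, η * (8 * s + 2 * W) ≤ e / 2 := by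
    refine ⟨e / (2 * (8 * s + 2 * W + e)), ⟨by positivity, ?_⟩, ?_⟩
    · rw [div_lt_one (by positivity)]; linarith
    · rw [div_mul_eq_mul_div, div_le_div_iff₀ (by positivity) two_pos]
      nlinarith [mul_pos he he]
  have hηu : 0 < η * u := mul_pos hη.1 hu.1
  set L : ℝ := ∑ i, (c i).toFun 0 / (η * u)
  have hLi0 : ∀ i, 0 ≤ (c i).toFun 0 / (η * u) := fun i => div_nonneg ((c i).nonneg 0 m0) hηu.le
  have hL0 : 0 ≤ L := Finset.sum_nonneg fun i _ => hLi0 i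
  have hLi : ∀ i, (c i).toFun 0 / (η * u) ≤ L := fun i =>
    Finset.single_le_sum (f := fun i => (c i).toFun 0 / (η * u)) (fun i _ => hLi0 i)
      (Finset.mem_univ i)
  have hlip : ∀ i, ∀ a ∈ Set.Icc (0 : ℝ) 1, ∀ b ∈ Set.Icc (0 : ℝ) 1, a ≤ b →
      (c i).mix η u a - (c i).mix η u b ≤ L * (b - a) := fun i a ha b hb hab =>
    ((c i).mix_sub_le hη hu ha hb hab).trans
      (mul_le_mul_of_nonneg_right (hLi i) (sub_nonneg.2 hab))
  obtain ⟨R, hR0, hR⟩ : ∃ R : ℕ, 0 < R ∧ Fintype.card M * (8 * (L / ((N * R : ℕ) : ℝ))) ≤ e / 2 := by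
    obtain ⟨R, hR⟩ := exists_nat_gt (16 * Fintype.card M * L / e)
    have hRpos : (0 : ℝ) < R := lt_of_le_of_lt (by positivity) hR
    have hNR : (R : ℝ) ≤ ((N * R : ℕ) : ℝ) := by
      exact_mod_cast Nat.le_mul_of_pos_left R hz.pos
    refine ⟨R, by exact_mod_cast hRpos, ?_⟩
    rw [div_lt_iff₀ he] at hR
    rw [← mul_div_assoc, ← mul_div_assoc, div_le_iff₀ (hRpos.trans_le hNR)]
    nlinarith
  have hz' := hz.refineSlots hR0
  set N' := N * R
  have hN' : (0 : ℝ) < N' := by exact_mod_cast hz'.pos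
  obtain ⟨K, hK⟩ := exists_nat_gt (∑ i, L / w i)
  have hK0 : (0 : ℝ) < K :=
    lt_of_le_of_lt (Finset.sum_nonneg fun i _ => div_nonneg hL0 (hw i).le) hK
  have hLK : ∀ i, L / K ≤ w i := by
    intro i
    have h1 := Finset.single_le_sum (f := fun i => L / w i)
      (fun i _ => div_nonneg hL0 (hw i).le) (Finset.mem_univ i)
    have h2 := h1.trans hK.le
    rw [div_le_iff₀ (hw i)] at h2
    rw [div_le_iff₀ hK0]; linarith
  set slope : M → ℕ → ℝ := fun i j =>
    (c i).mix η u ((j : ℝ) / N') - (c i).mix η u (((j : ℝ) + 1) / N') with hslope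
  -- The request is served in `K` substeps, with `K` so large that each force is at most the weight.
  set g : M → ℕ → ℝ := fun i j => if j < N' then N' * slope i j / K else 0 with hg_def
  have hg : ∀ i j, g i j ∈ Set.Icc 0 (w i) := by
    intro i j
    simp only [hg_def]
    split_ifs with hj
    · have hj' : (j : ℝ) + 1 ≤ N' := by exact_mod_cast hj
      have hj0 : (0 : ℝ) ≤ j := Nat.cast_nonneg j
      have m2 : (j : ℝ) / N' ∈ Set.Icc (0 : ℝ) 1 :=
        ⟨div_nonneg hj0 hN'.le, (div_le_one hN').2 (by linarith)⟩
      have m3 : ((j : ℝ) + 1) / N' ∈ Set.Icc (0 : ℝ) 1 :=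
        ⟨div_nonneg (by linarith) hN'.le, (div_le_one hN').2 hj'⟩
      have hle : (j : ℝ) / N' ≤ ((j : ℝ) + 1) / N' :=
        div_le_div_of_nonneg_right (by linarith) hN'.le
      have h1 : 0 ≤ slope i j := sub_nonneg.2 ((c i).mix_antitoneOn hη hu m2 m3 hle)
      have h2 : N' * slope i j ≤ L := by
        have h3 := mul_le_mul_of_nonneg_left (hlip i _ m2 _ m3 hle) hN'.le
        have h4 : (N' : ℝ) * (L * (((j : ℝ) + 1) / N' - (j : ℝ) / N')) = L := by
          field_simp; ring
        linarith
      exact ⟨by positivity, (div_le_div_of_nonneg_right h2 hK0.le).trans (hLK i)⟩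
    · exact ⟨le_rfl, (hw i).le⟩
  have hgsum : ∀ v : M → ℕ → ℝ, K * ((∑ i, ∑ j ∈ Finset.range N', v i j * g i j) / N')
      = ∑ i, ∑ j ∈ Finset.range N', v i j * slope i j := by
    intro v
    rw [Finset.sum_div, Finset.mul_sum]
    refine Finset.sum_congr rfl fun i _ => ?_
    rw [Finset.sum_div, Finset.mul_sum]
    refine Finset.sum_congr rfl fun j hj => ?_
    simp only [hg_def, if_pos (Finset.mem_range.1 hj)]
    field_simp
  obtain ⟨b, z', hb, hz'', hbest⟩ := exists_best_substep hw hu.1 hnu hz' hg K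
  have hbm := hb.slotAlloc_mem
  have hbI : ∀ i, slotAlloc N' b i ∈ Set.Icc (0 : ℝ) 1 := fun i =>
    ⟨hbm.1 i, le_one_of_mem_stdSimplex hbm i⟩
  refine ⟨⟨fun i => (1 - η) * slotAlloc N' b i + η * u, fun i => (mix_mem hη hu (hbI i)).1, ?_⟩,
    N', z', hz'', fun y => ?_⟩
  · rw [Finset.sum_add_distrib, ← Finset.mul_sum, ← Finset.mul_sum, hbm.2, hsum_u]; ring
  set X : M → ℝ := fun i => (1 - η) * slotAlloc N' b i + η * u with hX
  have hdist : weightedDist w (slotAlloc N' b) X ≤ η * W := by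
    unfold weightedDist
    rw [Finset.mul_sum]
    refine Finset.sum_le_sum fun i _ => ?_
    rw [mul_comm η]
    refine mul_le_mul_of_nonneg_left ?_ (hw i).le
    have h1 : slotAlloc N' b i - X i = η * (slotAlloc N' b i - u) := by simp only [hX]; ring
    rw [h1, abs_mul, abs_of_pos hη.1]
    refine mul_le_of_le_one_right hη.1.le (abs_le.2 ⟨?_, ?_⟩) <;>
      linarith [(hbI i).1, (hbI i).2, hu.1, hu.2]
  have hw' : ∀ i, 0 ≤ w i := fun i => (hw i).le
  have t1 := weightedDist_triangle hw' (slotAlloc N z) (slotAlloc N' b) X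
  have t2 := weightedDist_triangle hw' X (slotAlloc N' b) (slotAlloc N' z')
  rw [weightedDist_comm w X (slotAlloc N' b)] at t2
  have h1 := hbest y.1 y.2
  rw [slotAlloc_refineSlots hR0, potential_refineSlots hR0, hgsum, mul_left_comm, hgsum] at h1
  have hserv : ∑ i, (c i).toFun (X i)
      ≤ ∑ i, (c i).mix η u 1 + ∑ i, ∑ j ∈ Finset.range N', b i j * slope i j := by
    rw [← Finset.sum_add_distrib]
    refine Finset.sum_le_sum fun i _ => ?_
    have := convexOn_le_sum_slots ((c i).mix_convexOn hη hu) (hb.mem i) (le_refl N')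
    rw [div_self hN'.ne'] at this
    exact this
  have hoff : ∑ i, ∑ j ∈ Finset.range N', deficit N' (y.1 i) j * slope i j
      ≤ serviceCost c y + η * s + Fintype.card M * (L / N') - ∑ i, (c i).mix η u 1 := by
    have h2 : ∀ i, ∑ j ∈ Finset.range N', deficit N' (y.1 i) j * slope i j
        ≤ ((c i).toFun (y.1 i) + η * (c i).toFun u + L / N') - (c i).mix η u 1 := by
      intro i
      have hyi : y.1 i ∈ Set.Icc (0 : ℝ) 1 := ⟨y.2.1 i, le_one_of_mem_stdSimplex y.2 i⟩
      have h3 := sum_deficit_mul_le ((c i).mix_antitoneOn hη hu) hL0 (hlip i) hz'.pos hyi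
      have h4 := (c i).mix_le hη hu hyi
      linarith
    have h3 := Finset.sum_le_sum fun i (_ : i ∈ Finset.univ) => h2 i
    rw [Finset.sum_sub_distrib, Finset.sum_add_distrib, Finset.sum_add_distrib, ← Finset.mul_sum,
      Finset.sum_const, Finset.card_univ, nsmul_eq_mul] at h3
    exact h3
  have hmix1 : 0 ≤ ∑ i, (c i).mix η u 1 := Finset.sum_nonneg fun i _ =>
    (c i).nonneg _ (mix_mem hη hu (Set.right_mem_Icc.2 zero_le_one))
  change weightedDist w (slotAlloc N z) X + weightedDist w X (slotAlloc N' z')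
    + ∑ i, (c i).toFun (X i) ≤ _
  linarith

/-! ### The online algorithm -/

/-- The state of the online algorithm: the number of requests served so far, the state `z` of the
slot dynamics, and the current allocation, which is in general not the one described by `z`. -/
structure OnlineState (M : Type*) [Fintype M] where
  time : ℕ
  N : ℕ
  z : M → ℕ → ℝ
  isProfile : IsProfile N z
  alloc : Allocation M

/-- With a single slot per point every allocation can be represented. -/
def OnlineState.init (x : Allocation M) : OnlineState M where
  time := 0
  N := 1
  z i _ := 1 - x.1 i
  isProfile := ⟨one_pos, fun i _ => ⟨sub_nonneg.2 (le_one_of_mem_stdSimplex x.2 i),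
    sub_le_self _ (x.2.1 i)⟩, by simp [slotMass, x.2.2]⟩
  alloc := x

/-- The errors of the time steps are chosen as `1 / 2, 1 / 4, …`, with sum at most `1`. -/
theorem exists_next [Nonempty M] {w : M → ℝ} (hw : ∀ i, 0 < w i) (s : OnlineState M)
    (c : Request M) : ∃ s' : OnlineState M, s'.time = s.time + 1 ∧ ∀ y : Allocation M,
      weightedDist w (slotAlloc s.N s.z) s'.alloc.1
          + weightedDist w s'.alloc.1 (slotAlloc s'.N s'.z) + serviceCost c s'.alloc
        ≤ 8 * serviceCost c y + (potential w (1 / Fintype.card M) s.N s.z y.1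
          - potential w (1 / Fintype.card M) s'.N s'.z y.1) + (1 / 2) ^ (s.time + 1) := by
  obtain ⟨X, N', z', hz', h⟩ := exists_step hw s.isProfile c
    (show (0 : ℝ) < (1 / 2) ^ (s.time + 1) by positivity)
  exact ⟨⟨s.time + 1, N', z', hz', X⟩, rfl, h⟩

/-- A schedule that serves the requests by a rule as in `exists_next` is competitive. -/
theorem totalCost_le [MetricSpace M] [Nonempty M] {w : M → ℝ} (hw : ∀ i, 0 < w i)
    (hd : ∀ i j : M, i ≠ j → dist i j = w i + w j) {x₀ : Allocation M} {c : ℕ → Request M}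
    {s : ℕ → OnlineState M} (hs0 : s 0 = OnlineState.init x₀) (htime : ∀ t, (s t).time = t)
    (hs : ∀ t, ∀ y : Allocation M,
      weightedDist w (slotAlloc (s t).N (s t).z) (s (t + 1)).alloc.1
          + weightedDist w (s (t + 1)).alloc.1 (slotAlloc (s (t + 1)).N (s (t + 1)).z)
          + serviceCost (c t) (s (t + 1)).alloc
        ≤ 8 * serviceCost (c t) y + (potential w (1 / Fintype.card M) (s t).N (s t).z y.1
          - potential w (1 / Fintype.card M) (s (t + 1)).N (s (t + 1)).z y.1)
          + (1 / 2) ^ ((s t).time + 1))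
    {ρ : ℝ} (hρ : 8 ≤ ρ)
    (hρ' : 8 * Real.log ((1 + 1 / Fintype.card M) / (1 / (Fintype.card M : ℝ))) ≤ ρ)
    (T : ℕ) (y : ℕ → Allocation M) :
    totalCost c (fun t => (s t).alloc) T ≤ ρ * totalCost c y T
      + (potential w (1 / Fintype.card M) (s 0).N (s 0).z (y 0).1 + 1) := by
  have hδ : (0 : ℝ) < 1 / Fintype.card M := by
    have : (0 : ℝ) < Fintype.card M := by exact_mod_cast Fintype.card_pos
    positivity
  have hw' : ∀ i, 0 ≤ w i := fun i => (hw i).le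
  have key : ∀ T, totalCost c (fun t => (s t).alloc) T
      + potential w (1 / Fintype.card M) (s T).N (s T).z (y T).1
      + weightedDist w (s T).alloc.1 (slotAlloc (s T).N (s T).z)
      ≤ ρ * totalCost c y T + potential w (1 / Fintype.card M) (s 0).N (s 0).z (y 0).1
        + (1 - (1 / 2) ^ T) := by
    intro T
    induction T with
    | zero =>
      have : weightedDist w (s 0).alloc.1 (slotAlloc (s 0).N (s 0).z) = 0 := by
        rw [hs0]
        have h : slotAlloc (OnlineState.init x₀).N (OnlineState.init x₀).z = x₀.1 := by
          funext i; simp [slotAlloc, OnlineState.init]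
        rw [h]
        exact weightedDist_self _ _
      simp [totalCost, this]
    | succ T ih =>
      have h1 := hs T (y (T + 1))
      have h2 := potential_le_add hw hδ (s T).isProfile (y T).2 (y (T + 1)).2
      have h3 := weightedDist_triangle hw' (s T).alloc.1 (slotAlloc (s T).N (s T).z)
        (s (T + 1)).alloc.1
      have h4 : 0 ≤ weightedDist w (y T).1 (y (T + 1)).1 :=
        Finset.sum_nonneg fun i _ => mul_nonneg (hw' i) (abs_nonneg _)
      have h5 := mul_le_mul_of_nonneg_right hρ' h4
      have h6 := mul_le_mul_of_nonneg_right hρ (serviceCost_nonneg (c T) (y (T + 1)))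
      have h7 : ((1 : ℝ) / 2) ^ T = (1 / 2) ^ (T + 1) + (1 / 2) ^ (T + 1) := by
        rw [pow_succ]; ring
      rw [htime] at h1
      unfold totalCost at ih ⊢
      rw [Finset.sum_range_succ, Finset.sum_range_succ, movementCost_eq_weightedDist hw hd,
        movementCost_eq_weightedDist hw hd, mul_add, mul_add]
      linarith
  have h1 := key T
  have h2 := potential_nonneg hw hδ (s T).isProfile (y T).1
  have h3 : 0 ≤ weightedDist w (s T).alloc.1 (slotAlloc (s T).N (s T).z) :=
    Finset.sum_nonneg fun i _ => mul_nonneg (hw' i) (abs_nonneg _)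
  have h4 : (0 : ℝ) < (1 / 2) ^ T := by positivity
  linarith

theorem hasCompetitiveAlgorithm_of_weights [MetricSpace M] [Nonempty M] {w : M → ℝ}
    (hw : ∀ i, 0 < w i) (hd : ∀ i j : M, i ≠ j → dist i j = w i + w j) {ρ : ℝ} (hρ : 8 ≤ ρ)
    (hρ' : 8 * Real.log ((1 + 1 / Fintype.card M) / (1 / (Fintype.card M : ℝ))) ≤ ρ) :
    HasCompetitiveAlgorithm M ρ := by
  have hδ : (0 : ℝ) < 1 / Fintype.card M := by
    have : (0 : ℝ) < Fintype.card M := by exact_mod_cast Fintype.card_pos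
    positivity
  choose next htime hnext using exists_next (M := M) hw
  refine ⟨(8 * (1 + Real.log ((1 + 1 / Fintype.card M) / (1 / (Fintype.card M : ℝ)))) + 1)
    * ∑ i, w i + 1, fun x₀ => ⟨fun l => (l.foldl next (OnlineState.init x₀)).alloc, rfl,
    fun c T y _ => ?_⟩⟩
  set s : ℕ → OnlineState M := fun t => ((List.range t).map c).foldl next (OnlineState.init x₀)
    with hs_def
  have hsucc : ∀ t, s (t + 1) = next (s t) (c t) := by
    intro t
    simp [hs_def, List.range_succ]
  have ht : ∀ t, (s t).time = t := by
    intro t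
    induction t with
    | zero => rfl
    | succ t ih => rw [hsucc, htime, ih]
  have h := totalCost_le hw hd (x₀ := x₀) (c := c) (s := s) rfl ht
    (fun t y => by rw [hsucc]; exact hnext (s t) (c t) y) hρ hρ' T y
  have hB := potential_le hw hδ (s 0).isProfile (y 0).1
  change totalCost c (fun t => (s t).alloc) T ≤ _
  linarith

end MetricAllocation

end

theorem theorem1 :
    ∃ C : ℝ, 0 < C ∧
      ∀ (M : Type*) [Fintype M] [MetricSpace M],
        MetricAllocation.IsWeightedStar M → 2 ≤ Fintype.card M →
          MetricAllocation.HasCompetitiveAlgorithm M (C * Real.log (Fintype.card M : ℝ)) := by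
  refine ⟨16, by norm_num, fun M _ _ ⟨w, hw, hd⟩ hn => ?_⟩
  have hn' : (2 : ℝ) ≤ Fintype.card M := by exact_mod_cast hn
  have : Nonempty M := Fintype.card_pos_iff.1 (by omega)
  have hlog2 : (1 / 2 : ℝ) ≤ Real.log (Fintype.card M) := by
    have := Real.log_le_log two_pos hn'
    linarith [Real.log_two_gt_d9]
  refine MetricAllocation.hasCompetitiveAlgorithm_of_weights hw hd (by linarith) ?_
  have h1 : (1 + 1 / (Fintype.card M : ℝ)) / (1 / (Fintype.card M : ℝ))
      ≤ (Fintype.card M : ℝ) ^ 2 := by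
    have h0 : (Fintype.card M : ℝ) ≠ 0 := by linarith
    have e : (1 + 1 / (Fintype.card M : ℝ)) / (1 / (Fintype.card M : ℝ)) = Fintype.card M + 1 := by
      field_simp
    rw [e]
    nlinarith
  have h2 := Real.log_le_log (by positivity) h1
  rw [Real.log_pow] at h2
  push_cast at h2
  linarith
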